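/- A partial linear space is a pair $\Pi=(P,\mathcal L)$ of a non-empty set $P$ of points and a family $\mathcal L$ of proper subsets of $P$ (lines) such that every line has at least two points, every point lies on a line, and two distinct points lie on at most one common line; two points are collinear if some line contains both (in particular every point is collinear to itself). A subspace is a set of points containing every line that joins two of its distinct collinear points; $\langle X\rangle$ denotes the smallest subspace containing $X$; a subspace is singular if its points are mutually collinear, and it has dimension $k$ if it is spanned by an independent set of $k+1$ points. A polar space is a partial linear space in which (P1) every line has at least three points, (P2) no point is collinear to all points, (P3) for every point and every line the point is collinear to exactly one or to all points of the line, (P4) every chain of singular subspaces is finite; it has rank $n$ if all its maximal singular subspaces have dimension $n-1$. A thin polar space of rank $n\ge 2$ is a partial linear space isomorphic to the one with point set $\{\pm1,\dots,\pm n\}$ whose lines are the two-element subsets $\{i,j\}$ with $j\ne -i$. For $k\le n-2$, $\Gamma_k(\Pi)$ is the graph whose vertices are the $k$-dimensional singular subspaces of $\Pi$, two distinct ones being adjacent if some $(k+1)$-dimensional singular subspace contains both. An isometric embedding of graphs is an injection of the vertex sets that preserves adjacency, non-adjacency and the path distance. **Theorem.** Let $\Pi=(P,\mathcal L)$ be a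 polar space or a thin polar space of rank $n$, and let $\Pi'=(P',\mathcal L')$ be a polar space of the same rank $n$. Then every isometric embedding $f$ of $\Gamma_{n-2}(\Pi)$ in $\Gamma_{n-2}(\Pi')$ is induced by a collinearity preserving injection of $\Pi$ to $\Pi'$: there is an injection $\varphi:P\to P'$ sending collinear points to collinear points and non-collinear points to non-collinear points such that $f(S)=\langle\varphi(S)\rangle$ for every $(n-2)$-dimensional singular subspace $S$ of $\Pi$. -/

import Mathlib

universe u v

/-- A partial linear space with point set `P`; lines are sets of points. -/
structure PartialLinearSpace (P : Type u) where
  /-- The family of lines. -/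
  lines : Set (Set P)
  nonempty : Nonempty P
  line_proper : ∀ L ∈ lines, L ≠ Set.univ
  line_nontrivial : ∀ L ∈ lines, L.Nontrivial
  exists_line : ∀ p : P, ∃ L ∈ lines, p ∈ L
  line_unique : ∀ p q : P, p ≠ q → ∀ L ∈ lines, ∀ M ∈ lines,
    p ∈ L → q ∈ L → p ∈ M → q ∈ M → L = M

namespace PartialLinearSpace

variable {P : Type u} {P' : Type v}

/-- Two points are collinear if some line contains both. Every point lies on a line, so every
point is collinear to itself. -/
def Coll (Q : PartialLinearSpace P) (p q : P) : Prop :=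
  ∃ L ∈ Q.lines, p ∈ L ∧ q ∈ L

/-- A subspace contains the line joining any two of its distinct collinear points. -/
def IsSubspace (Q : PartialLinearSpace P) (S : Set P) : Prop :=
  ∀ p ∈ S, ∀ q ∈ S, p ≠ q → ∀ L ∈ Q.lines, p ∈ L → q ∈ L → L ⊆ S

/-- A singular subspace: a subspace whose points are mutually collinear. -/
def IsSingular (Q : PartialLinearSpace P) (S : Set P) : Prop :=
  Q.IsSubspace S ∧ ∀ p ∈ S, ∀ q ∈ S, Q.Coll p q

/-- The subspace spanned by `X`: the smallest subspace containing `X`. -/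
def span (Q : PartialLinearSpace P) (X : Set P) : Set P :=
  ⋂₀ {S | Q.IsSubspace S ∧ X ⊆ S}

/-- `X` is independent if no point of `X` lies in the subspace spanned by the other points. -/
def Indep (Q : PartialLinearSpace P) (X : Set P) : Prop :=
  ∀ x ∈ X, x ∉ Q.span (X \ {x})

/-- Projective dimension: `S` is `k`-dimensional if it has a basis (an independent spanning set)
of `k + 1` points. The empty set has dimension `-1`, a point `0`, a line `1`. -/
def HasDim (Q : PartialLinearSpace P) (S : Set P) (k : ℤ) : Prop :=
  ∃ X : Set P, X.Finite ∧ (X.ncard : ℤ) = k + 1 ∧ Q.Indep X ∧ Q.span X = S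

/-- The axioms of a polar space: every line has at least three points, no point is collinear to
all points, a point is collinear to one or all points of a line, and chains of singular subspaces
are finite. -/
structure IsPolarSpace (Q : PartialLinearSpace P) : Prop where
  three_points : ∀ L ∈ Q.lines, 3 ≤ L.encard
  no_universal_point : ¬ ∃ p, ∀ q, Q.Coll p q
  one_or_all : ∀ p, ∀ L ∈ Q.lines,
    (∃! q, q ∈ L ∧ Q.Coll p q) ∨ (∀ q ∈ L, Q.Coll p q)
  chain_finite : ∀ C : Set (Set P), (∀ S ∈ C, Q.IsSingular S) → IsChain (· ⊆ ·) C → C.Finite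

/-- A polar space of rank `n`: all maximal singular subspaces are `(n - 1)`-dimensional. -/
structure IsPolarSpaceOfRank (Q : PartialLinearSpace P) (n : ℕ) : Prop where
  isPolarSpace : Q.IsPolarSpace
  dim_maximal : ∀ M, Maximal Q.IsSingular M → Q.HasDim M ((n : ℤ) - 1)

/-- A collineation: a bijection of the point sets carrying the family of lines onto the family
of lines. -/
def IsCollineation (Q : PartialLinearSpace P) (Q' : PartialLinearSpace P') (e : P ≃ P') : Prop :=
  (fun L : Set P => e '' L) '' Q.lines = Q'.lines

/-- The standard thin polar space of rank `n ≥ 2`. The point set `{±1, …, ±n}` is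
`Fin n × Bool`, where `-(i, b) = (i, !b)`; the lines are the pairs of distinct non-opposite
points, that is, pairs of points with different first coordinates. -/
def thin (n : ℕ) (hn : 2 ≤ n) : PartialLinearSpace (Fin n × Bool) where
  lines := {L | ∃ x y : Fin n × Bool, x.1 ≠ y.1 ∧ L = {x, y}}
  nonempty := ⟨(⟨0, by omega⟩, true)⟩
  line_proper := by
    rintro L ⟨x, y, hxy, rfl⟩ h
    have h1 : ((x.1, !x.2) : Fin n × Bool) ∈ ({x, y} : Set (Fin n × Bool)) := by
      rw [h]; trivial
    rcases h1 with h1 | h1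
    · have := congrArg Prod.snd h1
      simp at this
    · rw [Set.mem_singleton_iff] at h1
      exact hxy (by rw [← h1])
  line_nontrivial := by
    rintro L ⟨x, y, hxy, rfl⟩
    exact Set.nontrivial_pair (fun h => hxy (congrArg Prod.fst h))
  exists_line := by
    intro p
    have : Nontrivial (Fin n) := Fin.nontrivial_iff_two_le.mpr hn
    obtain ⟨j, hj⟩ := exists_ne p.1
    exact ⟨{p, (j, true)}, ⟨p, (j, true), hj.symm, rfl⟩, by simp⟩
  line_unique := by
    rintro p q hpq L ⟨x, y, hxy, rfl⟩ M ⟨z, w, hzw, rfl⟩ h1 h2 h3 h4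
    simp only [Set.mem_insert_iff, Set.mem_singleton_iff] at h1 h2 h3 h4
    ext t
    simp only [Set.mem_insert_iff, Set.mem_singleton_iff]
    grind

/-- A thin polar space of rank `n`: a partial linear space isomorphic to the standard one. -/
def IsThinPolarSpaceOfRank (Q : PartialLinearSpace P) (n : ℕ) : Prop :=
  ∃ (hn : 2 ≤ n) (e : P ≃ Fin n × Bool), Q.IsCollineation (thin n hn) e

/-- The polar Grassmannian of `k`-dimensional singular subspaces. -/
def Grassmannian (Q : PartialLinearSpace P) (k : ℤ) : Type u :=
  {S : Set P // Q.IsSingular S ∧ Q.HasDim S k}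

/-- The polar Grassmann graph formed by `k`-dimensional singular subspaces, for non-maximal
subspaces (`k ≤ n - 2`, where `n` is the rank): two distinct vertices are adjacent if some
`(k + 1)`-dimensional singular subspace contains both. -/
def grassmannGraph (Q : PartialLinearSpace P) (k : ℤ) : SimpleGraph (Q.Grassmannian k) where
  Adj X Y := X ≠ Y ∧ ∃ U, Q.IsSingular U ∧ Q.HasDim U (k + 1) ∧ X.1 ⊆ U ∧ Y.1 ⊆ U
  symm := ⟨fun _ _ h => ⟨h.1.symm, h.2.imp fun _ hU => ⟨hU.1, hU.2.1, hU.2.2.2, hU.2.2.1⟩⟩⟩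
  loopless := ⟨fun _ h => h.1 rfl⟩

/-- A collinearity preserving injection: it sends collinear points to collinear points and
non-collinear points to non-collinear points. -/
def IsCollinearityPreservingInjection (Q : PartialLinearSpace P) (Q' : PartialLinearSpace P')
    (φ : P → P') : Prop :=
  Function.Injective φ ∧ ∀ p q, Q'.Coll (φ p) (φ q) ↔ Q.Coll p q

end PartialLinearSpace

/-- An isometric embedding of graphs: an embedding that preserves the path distance. -/
def SimpleGraph.Embedding.IsIsometric {V : Type u} {W : Type v} {G : SimpleGraph V}
    {H : SimpleGraph W} (f : G ↪g H) : Prop :=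
  ∀ x y : V, H.edist (f x) (f y) = G.edist x y

/-!
The third points of lines play no role in the argument, so polar spaces and thin polar spaces are
both treated as Shult spaces. Call maximal singular subspaces *generators*; the vertices of the
graph are then the hyperplanes of generators. Two vertices `X`, `Y` have distance at most `k + 1` if
and only if there are generators `M ⊇ X` and `N ⊇ Y` with `rank (M ∩ N) ≥ n - k`.

An isometric map `f` sends the hyperplanes of a generator `M` to pairwise adjacent vertices, which
lie in a common generator `F M`. A gallery from `M` to `N` shows that `F` does not decrease
`rank (M ∩ N)`. If `M` and `N` share a point `p`, it does not increase it either, because the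
distance of hyperplanes of `M` and `N` that miss `p` determines `rank (M ∩ N)`. So if `M ∩ N = {p}`,
then `F M ∩ F N` is a single point, and moving `M` and `N` along galleries shows that it depends
only on `p`; call it `φ p`. A vertex disjoint from the perp of `X` has the largest possible distance
`n` from `X`, whereas vertices with a common point are closer; hence `φ p ∉ f X` unless `p` is
collinear to all of `X`. Injectivity of `φ` and the preservation of collinearity follow from this.
-/

namespace PartialLinearSpace

open Set

variable {P : Type u} {P' : Type v} {Q : PartialLinearSpace P} {Q' : PartialLinearSpace P'} {n : ℕ}

/-! ### Spans and perps -/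

/-- The perp of `A`: the set of points collinear to all points of `A`. -/
def perp (Q : PartialLinearSpace P) (A : Set P) : Set P := {p | ∀ a ∈ A, Q.Coll p a}

/-- A clique of the collinearity graph: a set of mutually collinear points, not necessarily a
subspace. -/
def IsClique (Q : PartialLinearSpace P) (A : Set P) : Prop := A ⊆ Q.perp A

theorem coll_refl (p : P) : Q.Coll p p :=
  let ⟨L, hL, hp⟩ := Q.exists_line p
  ⟨L, hL, hp, hp⟩

theorem Coll.symm {p q : P} (h : Q.Coll p q) : Q.Coll q p :=
  let ⟨L, hL, hp, hq⟩ := h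
  ⟨L, hL, hq, hp⟩

theorem subset_span (X : Set P) : X ⊆ Q.span X := fun _ hx _ hS => hS.2 hx

theorem mem_span_insert (x : P) (X : Set P) : x ∈ Q.span (insert x X) :=
  subset_span _ (mem_insert x X)

theorem subset_span_insert (x : P) (X : Set P) : X ⊆ Q.span (insert x X) :=
  (subset_insert x X).trans (subset_span _)

theorem isSubspace_span (X : Set P) : Q.IsSubspace (Q.span X) :=
  fun p hp q hq hpq L hL hpL hqL _ hz S hS =>
    hS.1 p (hp S hS) q (hq S hS) hpq L hL hpL hqL hz

theorem span_subset {X S : Set P} (hS : Q.IsSubspace S) (h : X ⊆ S) : Q.span X ⊆ S :=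
  fun _ hx => hx S ⟨hS, h⟩

theorem span_mono {X Y : Set P} (h : X ⊆ Y) : Q.span X ⊆ Q.span Y :=
  span_subset (isSubspace_span Y) (h.trans (subset_span Y))

theorem IsSubspace.span_eq {S : Set P} (hS : Q.IsSubspace S) : Q.span S = S :=
  (span_subset hS subset_rfl).antisymm (subset_span S)

theorem span_insert_span (x : P) (X : Set P) :
    Q.span (insert x (Q.span X)) = Q.span (insert x X) :=
  (span_subset (isSubspace_span _)
    (insert_subset (mem_span_insert x X) (span_mono (subset_insert x X)))).antisymm
    (span_mono (insert_subset_insert (subset_span X)))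

protected theorem IsSubspace.inter {S T : Set P} (hS : Q.IsSubspace S) (hT : Q.IsSubspace T) :
    Q.IsSubspace (S ∩ T) :=
  fun p hp q hq hpq L hL hpL hqL _ hz =>
    ⟨hS p hp.1 q hq.1 hpq L hL hpL hqL hz, hT p hp.2 q hq.2 hpq L hL hpL hqL hz⟩

@[simp]
theorem mem_perp_singleton {p q : P} : p ∈ Q.perp {q} ↔ Q.Coll p q := by
  simp [perp]

theorem perp_insert (x : P) (A : Set P) : Q.perp (insert x A) = Q.perp {x} ∩ Q.perp A := by
  ext
  simp [perp]

theorem subset_perp_comm {A B : Set P} : A ⊆ Q.perp B ↔ B ⊆ Q.perp A :=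
  ⟨fun h b hb _ ha => (h ha b hb).symm, fun h a ha _ hb => (h hb a ha).symm⟩

theorem perp_anti {A B : Set P} (h : A ⊆ B) : Q.perp B ⊆ Q.perp A := fun _ hp a ha => hp a (h ha)

theorem subset_perp_perp (A : Set P) : A ⊆ Q.perp (Q.perp A) := subset_perp_comm.1 subset_rfl

protected theorem IsClique.subset {A B : Set P} (hB : Q.IsClique B) (h : A ⊆ B) : Q.IsClique A :=
  (h.trans hB).trans (perp_anti h)

theorem IsClique.perp_perp {A : Set P} (hA : Q.IsClique A) : Q.IsClique (Q.perp (Q.perp A)) :=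
  (perp_anti hA).trans (subset_perp_perp _)

theorem isClique_singleton (p : P) : Q.IsClique {p} := by
  simp [IsClique, coll_refl]

protected theorem IsClique.union {A B : Set P} (hA : Q.IsClique A) (hB : Q.IsClique B)
    (h : B ⊆ Q.perp A) : Q.IsClique (A ∪ B) := by
  rintro p (hp | hp) q (hq | hq)
  · exact hA hp q hq
  · exact (h hq p hp).symm
  · exact h hp q hq
  · exact hB hp q hq

protected theorem IsClique.insert {A : Set P} (hA : Q.IsClique A) {x : P} (hx : x ∈ Q.perp A) :
    Q.IsClique (insert x A) := by
  rw [← union_singleton]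
  exact hA.union (isClique_singleton x) (singleton_subset_iff.2 hx)

theorem IsSingular.isClique {S : Set P} (hS : Q.IsSingular S) : Q.IsClique S := hS.2

protected theorem IsSingular.inter {S T : Set P} (hS : Q.IsSingular S) (hT : Q.IsSubspace T) :
    Q.IsSingular (S ∩ T) :=
  ⟨hS.1.inter hT, hS.isClique.subset inter_subset_left⟩

theorem isSingular_empty : Q.IsSingular ∅ := ⟨fun _ ha => ha.elim, fun _ ha => ha.elim⟩

theorem isSingular_singleton (p : P) : Q.IsSingular {p} :=
  ⟨fun _ ha _ hb hab => (hab (ha.trans hb.symm)).elim, isClique_singleton p⟩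

/-! ### Shult spaces -/

/-- A nondegenerate Shult space of finite rank: the axioms of a polar space, except that lines may
have only two points. This covers polar spaces and thin polar spaces at once. -/
class IsShultSpace (Q : PartialLinearSpace P) : Prop where
  no_universal_point : ¬ ∃ p, ∀ q, Q.Coll p q
  one_or_all : ∀ p, ∀ L ∈ Q.lines,
    (∃! q, q ∈ L ∧ Q.Coll p q) ∨ (∀ q ∈ L, Q.Coll p q)
  chain_finite : ∀ C : Set (Set P), (∀ S ∈ C, Q.IsSingular S) → IsChain (· ⊆ ·) C → C.Finite

/-- A Shult space of rank `n`: all maximal singular subspaces are `(n - 1)`-dimensional. The rank is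
an `outParam` because it is determined by the space. -/
class IsShultSpaceOfRank (Q : PartialLinearSpace P) (n : outParam ℕ) : Prop
    extends Q.IsShultSpace where
  dim_maximal : ∀ M, Maximal Q.IsSingular M → Q.HasDim M ((n : ℤ) - 1)

theorem IsPolarSpaceOfRank.isShultSpaceOfRank (h : Q.IsPolarSpaceOfRank n) :
    Q.IsShultSpaceOfRank n where
  no_universal_point := h.1.no_universal_point
  one_or_all := h.1.one_or_all
  chain_finite := h.1.chain_finite
  dim_maximal := h.2

namespace IsCollineation

variable {hn : 2 ≤ n} {e : P ≃ Fin n × Bool}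

theorem mem_lines_iff (he : Q.IsCollineation (thin n hn) e) (L : Set P) :
    L ∈ Q.lines ↔ ∃ x y, (e x).1 ≠ (e y).1 ∧ L = {x, y} := by
  have hinj : Function.Injective fun L : Set P => e '' L := e.injective.image_injective
  rw [← hinj.mem_set_image (s := Q.lines), show (fun L : Set P => e '' L) '' Q.lines = _ from he]
  constructor
  · rintro ⟨x, y, hxy, hL⟩
    refine ⟨e.symm x, e.symm y, by simpa using hxy, hinj ?_⟩
    simpa [image_pair] using hL
  · rintro ⟨x, y, hxy, rfl⟩
    exact ⟨e x, e y, hxy, image_pair e x y⟩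

theorem coll_iff (he : Q.IsCollineation (thin n hn) e) {p q : P} :
    Q.Coll p q ↔ p = q ∨ (e p).1 ≠ (e q).1 := by
  constructor
  · rintro ⟨L, hL, hp, hq⟩
    obtain ⟨x, y, hxy, rfl⟩ := (he.mem_lines_iff L).1 hL
    rcases hp with rfl | rfl <;> rcases hq with rfl | rfl
    exacts [.inl rfl, .inr hxy, .inr hxy.symm, .inl rfl]
  · rintro (rfl | hpq)
    · exact coll_refl p
    · exact ⟨{p, q}, (he.mem_lines_iff _).2 ⟨p, q, hpq, rfl⟩, by simp, by simp⟩

theorem isSubspace (he : Q.IsCollineation (thin n hn) e) (S : Set P) : Q.IsSubspace S := by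
  intro p hp q hq hpq L hL hpL hqL
  obtain ⟨x, y, -, rfl⟩ := (he.mem_lines_iff L).1 hL
  grind

theorem no_universal_point (he : Q.IsCollineation (thin n hn) e) :
    ¬ ∃ p, ∀ q, Q.Coll p q := by
  rintro ⟨p, hp⟩
  rcases he.coll_iff.1 (hp (e.symm ((e p).1, !(e p).2))) with h | h
  · simpa using congrArg (fun x => (e x).2) h
  · simp at h

theorem one_or_all (he : Q.IsCollineation (thin n hn) e) (p : P) {L : Set P} (hL : L ∈ Q.lines) :
    (∃! q, q ∈ L ∧ Q.Coll p q) ∨ (∀ q ∈ L, Q.Coll p q) := by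
  obtain ⟨x, y, hxy, rfl⟩ := (he.mem_lines_iff L).1 hL
  have hor : Q.Coll p x ∨ Q.Coll p y := by
    simp only [he.coll_iff]
    grind
  simp only [ExistsUnique, mem_insert_iff, mem_singleton_iff]
  grind

theorem exists_mem_fst_eq (he : Q.IsCollineation (thin n hn) e) {M : Set P}
    (hM : Maximal Q.IsSingular M) (i : Fin n) : ∃ p ∈ M, (e p).1 = i := by
  by_contra! hi
  have hx : e.symm (i, true) ∈ Q.perp M := fun a ha =>
    he.coll_iff.2 (.inr (by simpa using (hi a ha).symm))
  have hxM : e.symm (i, true) ∈ M := hM.2 (y := insert (e.symm (i, true)) M)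
    ⟨he.isSubspace _, hM.1.isClique.insert hx⟩ (subset_insert _ _) (mem_insert _ _)
  exact hi _ hxM (by simp)

theorem hasDim_of_maximal (he : Q.IsCollineation (thin n hn) e) {M : Set P}
    (hM : Maximal Q.IsSingular M) : Q.HasDim M ((n : ℤ) - 1) := by
  have : Finite P := .of_equiv _ e.symm
  have hspan (X : Set P) : Q.span X = X := (he.isSubspace X).span_eq
  refine ⟨M, M.toFinite, ?_, fun x _ hx => by simp [hspan] at hx, hspan M⟩
  have hinj : InjOn (fun p => (e p).1) M := fun p hp q hq hpq =>
    (he.coll_iff.1 (hM.1.2 p hp q hq)).resolve_right (not_not.2 hpq)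
  have himage : (fun p => (e p).1) '' M = univ := eq_univ_of_forall (he.exists_mem_fst_eq hM)
  rw [← hinj.ncard_image, himage, ncard_univ]
  simp

end IsCollineation

theorem IsThinPolarSpaceOfRank.isShultSpaceOfRank (h : Q.IsThinPolarSpaceOfRank n) :
    Q.IsShultSpaceOfRank n := by
  obtain ⟨hn, e, he⟩ := h
  have : Finite P := .of_equiv _ e.symm
  exact
    { no_universal_point := he.no_universal_point
      one_or_all := fun p _ hL => he.one_or_all p hL
      chain_finite := fun C _ _ => C.toFinite
      dim_maximal := fun _ hM => he.hasDim_of_maximal hM }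

section IsShultSpace

variable [Q.IsShultSpace]

theorem exists_mem_line_coll (p : P) {L : Set P} (hL : L ∈ Q.lines) : ∃ q ∈ L, Q.Coll p q := by
  rcases IsShultSpace.one_or_all p L hL with ⟨q, hq, -⟩ | hall
  · exact ⟨q, hq.1, hq.2⟩
  · obtain ⟨q, hq⟩ := (Q.line_nontrivial L hL).nonempty
    exact ⟨q, hq, hall q hq⟩

theorem isSubspace_perp (A : Set P) : Q.IsSubspace (Q.perp A) := by
  intro p hp q hq hpq L hL hpL hqL z hz a ha
  rcases IsShultSpace.one_or_all a L hL with ⟨r, -, hr⟩ | hall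
  · exact absurd ((hr p ⟨hpL, (hp a ha).symm⟩).trans (hr q ⟨hqL, (hq a ha).symm⟩).symm) hpq
  · exact (hall z hz).symm

theorem coll_of_mem_line {p a b c : P} {L : Set P} (hL : L ∈ Q.lines) (ha : a ∈ L) (hb : b ∈ L)
    (hc : c ∈ L) (hab : a ≠ b) (hpa : Q.Coll a p) (hpb : Q.Coll b p) : Q.Coll c p :=
  mem_perp_singleton.1 (isSubspace_perp {p} a (mem_perp_singleton.2 hpa) b
    (mem_perp_singleton.2 hpb) hab L hL ha hb hc)

theorem span_subset_perp_perp (A : Set P) : Q.span A ⊆ Q.perp (Q.perp A) :=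
  span_subset (isSubspace_perp _) (subset_perp_perp A)

@[simp]
theorem perp_span (A : Set P) : Q.perp (Q.span A) = Q.perp A :=
  (perp_anti (subset_span A)).antisymm (subset_perp_comm.1 (span_subset_perp_perp A))

theorem IsClique.isSingular_span {A : Set P} (hA : Q.IsClique A) : Q.IsSingular (Q.span A) :=
  ⟨isSubspace_span A, hA.perp_perp.subset (span_subset_perp_perp A)⟩

theorem perp_perp_exchange {A : Set P} {x z : P} (hA : Q.IsClique (insert x A))
    (hz : z ∈ Q.perp (Q.perp (insert x A))) (hzA : z ∉ Q.perp (Q.perp A)) :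
    x ∈ Q.perp (Q.perp (insert z A)) := by
  obtain ⟨q', hq', hzq'⟩ : ∃ q' ∈ Q.perp A, ¬ Q.Coll z q' := by simpa [perp] using hzA
  have hzins : z ∈ Q.perp (insert x A) := perp_anti hA hz
  rw [perp_insert, mem_inter_iff, mem_perp_singleton] at hzins
  obtain ⟨hzx, hzA⟩ := hzins
  intro q hq
  rw [perp_insert, mem_inter_iff, mem_perp_singleton] at hq
  obtain ⟨⟨L, hL, hqL, hzL⟩, hqA⟩ := hq
  by_contra hxq
  have hqz : q ≠ z := by rintro rfl; exact hxq hzx.symm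
  obtain ⟨r, hrL, K, hK, hq'K, hrK⟩ := exists_mem_line_coll q' hL
  have hrz : r ≠ z := by rintro rfl; exact hzq' ⟨K, hK, hrK, hq'K⟩
  have hzr : Q.Coll z r := ⟨L, hL, hzL, hrL⟩
  have hrA : r ∈ Q.perp A := isSubspace_perp A q hqA z hzA hqz L hL hqL hzL hrL
  have hrx : ¬ Q.Coll r x := fun h => hxq (coll_of_mem_line hL hrL hzL hqL hrz h hzx).symm
  have hrq' : r ≠ q' := by rintro rfl; exact hzq' hzr
  obtain ⟨t, htK, hxt⟩ := exists_mem_line_coll x hK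
  have htr : t ≠ r := by rintro rfl; exact hrx hxt.symm
  have ht : t ∈ Q.perp (insert x A) := by
    rw [perp_insert, mem_inter_iff, mem_perp_singleton]
    exact ⟨hxt.symm, isSubspace_perp A r hrA q' hq' hrq' K hK hrK hq'K htK⟩
  exact hzq' (coll_of_mem_line hK htK hrK hq'K htr (hz t ht).symm hzr.symm).symm

theorem span_insert_eq_perp_perp {S : Set P} (hS : Q.IsClique S)
    (hcl : Q.perp (Q.perp S) = S) {x : P} (hx : x ∈ Q.perp S) :
    Q.span (insert x S) = Q.perp (Q.perp (insert x S)) := by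
  refine (span_subset_perp_perp _).antisymm fun z hz => ?_
  by_cases hxS : x ∈ S
  · rw [insert_eq_of_mem hxS, hcl] at hz
    exact subset_span_insert x S hz
  by_cases hzx : z = x
  · rw [hzx]
    exact mem_span_insert x S
  obtain ⟨q, hq, hxq⟩ : ∃ q ∈ Q.perp S, ¬ Q.Coll x q := by
    have hx' : x ∉ Q.perp (Q.perp S) := hcl.symm ▸ hxS
    simpa [perp] using hx'
  have hclique := hS.insert hx
  have hxcl := subset_perp_perp (Q := Q) (insert x S) (mem_insert x S)
  obtain ⟨L, hL, hzL, hxL⟩ := hclique.perp_perp hz x hxcl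
  obtain ⟨w, hwL, hqw⟩ := exists_mem_line_coll q hL
  have hwx : w ≠ x := by rintro rfl; exact hxq hqw.symm
  have hw : w ∈ Q.perp (Q.perp (insert x S)) :=
    isSubspace_perp _ z hz x hxcl hzx L hL hzL hxL hwL
  have hwS : w ∈ S := by
    by_contra hwS
    refine hxq (perp_perp_exchange hclique hw (by rwa [hcl]) q ?_)
    rw [perp_insert]
    exact ⟨mem_perp_singleton.2 hqw, hq⟩
  exact isSubspace_span _ w (subset_span_insert x S hwS) x (mem_span_insert x S) hwx L hL hwL hxL
    hzL

theorem span_eq_perp_perp_of_finite {X : Set P} (hX : X.Finite) (hc : Q.IsClique X) :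
    Q.span X = Q.perp (Q.perp X) := by
  induction X, hX using Set.Finite.induction_on with
  | empty =>
    refine (span_subset_perp_perp _).antisymm fun z hz => ?_
    exact absurd ⟨z, fun q => hz q (by simp [perp])⟩ (IsShultSpace.no_universal_point (Q := Q))
  | @insert a s _ _ ih =>
    have hs := hc.subset (subset_insert a s)
    have hcl : Q.perp (Q.perp (Q.span s)) = Q.span s := by rw [perp_span, ih hs]
    have ha : a ∈ Q.perp (Q.span s) := by
      rw [perp_span]
      exact perp_anti (subset_insert a s) (hc (mem_insert a s))
    rw [← span_insert_span, span_insert_eq_perp_perp hs.isSingular_span.isClique hcl ha,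
      perp_insert, perp_insert, perp_span]

theorem exists_maximal_of_isSingular {p : Set P → Prop} (hp : ∀ S, p S → Q.IsSingular S)
    {S : Set P} (hS : p S) : ∃ M, S ⊆ M ∧ Maximal p M := by
  refine zorn_subset_nonempty {S | p S} (fun C hC hchain hne => ?_) S hS
  obtain ⟨M, hM⟩ :=
    (IsShultSpace.chain_finite C (fun T hT => hp T (hC hT)) hchain).exists_maximal hne
  exact ⟨M, hC hM.1, fun T hT => (hchain.total hT hM.1).elim id fun hMT => hM.2 hT hMT⟩

theorem IsClique.exists_finite_span_eq {A : Set P} (hA : Q.IsClique A) :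
    ∃ X ⊆ A, X.Finite ∧ Q.span X = Q.span A := by
  obtain ⟨_, -, ⟨X, hXA, hX, rfl⟩, hmax⟩ := exists_maximal_of_isSingular
    (p := fun S => ∃ X ⊆ A, X.Finite ∧ Q.span X = S)
    (by rintro _ ⟨X, hXA, -, rfl⟩; exact (hA.subset hXA).isSingular_span)
    ⟨∅, empty_subset A, finite_empty, rfl⟩
  refine ⟨X, hXA, hX, (span_mono hXA).antisymm (span_subset (isSubspace_span X) fun a ha => ?_)⟩
  exact hmax ⟨insert a X, insert_subset ha hXA, hX.insert a, rfl⟩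
    (span_mono (subset_insert a X)) (mem_span_insert a X)

theorem IsClique.span_eq_perp_perp {A : Set P} (hA : Q.IsClique A) :
    Q.span A = Q.perp (Q.perp A) := by
  obtain ⟨X, hXA, hX, hspan⟩ := hA.exists_finite_span_eq
  rw [← hspan, span_eq_perp_perp_of_finite hX (hA.subset hXA), ← perp_span X, hspan, perp_span]

theorem IsClique.mem_span_insert_exchange {A : Set P} {x z : P} (hA : Q.IsClique (insert x A))
    (hz : z ∈ Q.span (insert x A)) (hzA : z ∉ Q.span A) : x ∈ Q.span (insert z A) := by
  have hzc : Q.IsClique (insert z A) := hA.isSingular_span.isClique.subset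
    (insert_subset hz (subset_span_insert x A))
  rw [hA.span_eq_perp_perp] at hz
  rw [(hA.subset (subset_insert x A)).span_eq_perp_perp] at hzA
  rw [hzc.span_eq_perp_perp]
  exact perp_perp_exchange hA hz hzA

theorem IsSingular.exists_mem_perp_not_coll {S : Set P} (hS : Q.IsSingular S) {x : P}
    (hx : x ∉ S) : ∃ q ∈ Q.perp S, ¬ Q.Coll x q := by
  rw [← hS.1.span_eq, hS.isClique.span_eq_perp_perp] at hx
  simpa [perp] using hx

end IsShultSpace

/-! ### Bases and rank -/

theorem Indep.subset {I J : Set P} (hJ : Q.Indep J) (h : I ⊆ J) : Q.Indep I :=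
  fun x hx hmem => hJ x (h hx) (span_mono (sdiff_subset_sdiff_left h) hmem)

theorem Indep.eq_of_subset_of_subset_span {I J : Set P} (hJ : Q.Indep J) (hIJ : I ⊆ J)
    (hspan : J ⊆ Q.span I) : I = J := by
  refine hIJ.antisymm fun x hx => ?_
  by_contra hxI
  exact hJ x hx (span_mono (subset_sdiff_singleton hIJ hxI) (hspan hx))

/-- `I` is a basis of the set `A`, which need not be a subspace: an independent subset of `A` whose
span contains `A`. -/
structure IsBasis (Q : PartialLinearSpace P) (I A : Set P) : Prop where
  subset : I ⊆ A
  indep : Q.Indep I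
  subset_span : A ⊆ Q.span I

theorem IsBasis.span_eq {I A : Set P} (hI : Q.IsBasis I A) : Q.span I = Q.span A :=
  (span_mono hI.subset).antisymm (span_subset (isSubspace_span I) hI.subset_span)

theorem isBasis_empty : Q.IsBasis ∅ ∅ := ⟨subset_rfl, fun _ hx => hx.elim, empty_subset _⟩

section IsShultSpace

variable [Q.IsShultSpace]

theorem Indep.insert_of_notMem_span {I : Set P} {x : P} (hI : Q.Indep I)
    (hc : Q.IsClique (insert x I)) (hx : x ∉ Q.span I) : Q.Indep (insert x I) := by
  have hxI : x ∉ I := fun hxI => hx (subset_span I hxI)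
  rintro y (rfl | hy) hmem
  · rw [insert_sdiff_of_mem _ (mem_singleton y), sdiff_singleton_eq_self hxI] at hmem
    exact hx hmem
  · have hyx : x ≠ y := by rintro rfl; exact hxI hy
    rw [insert_sdiff_of_notMem _ (by simpa using hyx)] at hmem
    have hexch := (hc.subset (insert_subset_insert sdiff_subset)).mem_span_insert_exchange hmem
      (hI y hy)
    rw [insert_sdiff_singleton, insert_eq_of_mem hy] at hexch
    exact hx hexch

theorem Indep.finite {I : Set P} (hI : Q.Indep I) (hc : Q.IsClique I) :
    I.Finite := by
  obtain ⟨X, hXI, hX, hspan⟩ := hc.exists_finite_span_eq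
  rwa [← hI.eq_of_subset_of_subset_span hXI (hspan ▸ subset_span I)]

theorem IsBasis.insert {I A : Set P} {x : P} (hI : Q.IsBasis I A)
    (hc : Q.IsClique (insert x A)) (hx : x ∉ Q.span A) :
    Q.IsBasis (insert x I) (insert x A) where
  subset := insert_subset_insert hI.subset
  indep := hI.indep.insert_of_notMem_span (hc.subset (insert_subset_insert hI.subset))
    (hI.span_eq ▸ hx)
  subset_span := insert_subset (mem_span_insert x I)
    (hI.subset_span.trans (span_mono (subset_insert x I)))

theorem isBasis_of_maximal {A B : Set P} (hA : Q.IsClique A)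
    (hB : Maximal (fun X => X ⊆ A ∧ Q.Indep X) B) : Q.IsBasis B A where
  subset := hB.1.1
  indep := hB.1.2
  subset_span x hx := by
    by_contra hxB
    have hsub := insert_subset hx hB.1.1
    exact hxB (subset_span B (hB.2 ⟨hsub, hB.1.2.insert_of_notMem_span (hA.subset hsub) hxB⟩
      (subset_insert x B) (mem_insert x B)))

theorem indep_of_forall_finite {I : Set P} (hc : Q.IsClique I)
    (hI : ∀ J ⊆ I, J.Finite → Q.Indep J) : Q.Indep I := by
  intro x hx hmem
  obtain ⟨X, hXI, hX, hspan⟩ := (hc.subset (sdiff_subset (t := {x}))).exists_finite_span_eq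
  have hxX : x ∉ X := fun hxX => (hXI hxX).2 rfl
  refine hI (insert x X) (insert_subset hx (hXI.trans sdiff_subset)) (hX.insert x) x
    (mem_insert x X) ?_
  rwa [insert_sdiff_of_mem _ (mem_singleton x), sdiff_singleton_eq_self hxX, hspan]

theorem exists_indep_insert {A I B : Set P} (hA : Q.IsClique A)
    (hI : I ⊆ A ∧ Q.Indep I) (hImax : ¬ Maximal (fun X => X ⊆ A ∧ Q.Indep X) I)
    (hB : Maximal (fun X => X ⊆ A ∧ Q.Indep X) B) :
    ∃ x ∈ B \ I, insert x I ⊆ A ∧ Q.Indep (insert x I) := by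
  obtain ⟨x, hxB, hxI⟩ : ∃ x ∈ B, x ∉ Q.span I := by
    by_contra! hBI
    refine hImax ⟨hI, fun J hJ hIJ => (hJ.2.eq_of_subset_of_subset_span hIJ ?_).ge⟩
    exact hJ.1.trans
      ((isBasis_of_maximal hA hB).subset_span.trans (span_subset (isSubspace_span I) hBI))
  have hsub := insert_subset (hB.1.1 hxB) hI.1
  exact ⟨x, ⟨hxB, fun hx => hxI (subset_span I hx)⟩, hsub,
    hI.2.insert_of_notMem_span (hA.subset hsub) hxI⟩

/-- The matroid of independent subsets of a clique. -/
def IsClique.matroid {A : Set P} (hA : Q.IsClique A) : Matroid P :=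
  (IndepMatroid.ofFinitary A (fun X => X ⊆ A ∧ Q.Indep X)
    ⟨empty_subset A, isBasis_empty.indep⟩
    (fun _ _ hJ hIJ => ⟨hIJ.trans hJ.1, hJ.2.subset hIJ⟩)
    (fun _ _ => exists_indep_insert hA)
    (fun I hI =>
      have hIA : I ⊆ A := fun x hx =>
        (hI {x} (singleton_subset_iff.2 hx) (finite_singleton x)).1 rfl
      ⟨hIA, indep_of_forall_finite (hA.subset hIA) fun J hJ hfin => (hI J hJ hfin).2⟩)
    (fun _ hI => hI.1)).matroid

theorem IsClique.matroid_isBasis_iff {A S I : Set P} (hA : Q.IsClique A)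
    (hSA : S ⊆ A) : hA.matroid.IsBasis I S ↔ Q.IsBasis I S := by
  constructor
  · intro hI
    refine ⟨hI.subset, hI.indep.2, fun x hx => ?_⟩
    by_contra hxI
    have hsub := insert_subset (hSA hx) hI.indep.1
    exact hxI (subset_span I (hI.mem_of_insert_indep hx
      ⟨hsub, hI.indep.2.insert_of_notMem_span (hA.subset hsub) hxI⟩))
  · intro hI
    have hIA := hI.subset.trans hSA
    refine Matroid.Indep.isBasis_of_forall_insert ⟨hIA, hI.indep⟩ hI.subset fun x hx =>
      ⟨fun hins => hx.2 ?_, insert_subset (hSA hx.1) hIA⟩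
    exact (hins.2.eq_of_subset_of_subset_span (subset_insert x I)
      (insert_subset (hI.subset_span hx.1) (subset_span I))).ge (mem_insert x I)

theorem IsClique.exists_isBasis_subset_isBasis {S T : Set P} (hT : Q.IsClique T)
    (hST : S ⊆ T) : ∃ I J, Q.IsBasis I S ∧ Q.IsBasis J T ∧ I ⊆ J := by
  obtain ⟨I, J, hI, hJ, hIJ⟩ := hT.matroid.exists_isBasis_subset_isBasis hST
  exact ⟨I, J, (hT.matroid_isBasis_iff hST).1 hI, (hT.matroid_isBasis_iff subset_rfl).1 hJ, hIJ⟩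

theorem IsClique.exists_isBasis {S : Set P} (hS : Q.IsClique S) :
    ∃ I, Q.IsBasis I S :=
  let ⟨_, J, _, hJ, _⟩ := hS.exists_isBasis_subset_isBasis subset_rfl
  ⟨J, hJ⟩

/-- The rank of a clique: the largest number of independent points in it. For a singular subspace
this is the projective dimension plus one. -/
noncomputable def rank (Q : PartialLinearSpace P) (A : Set P) : ℕ :=
  sSup (ncard '' {I | I ⊆ A ∧ Q.Indep I})

theorem IsBasis.rank_eq_ncard {I A : Set P} (hI : Q.IsBasis I A)
    (hA : Q.IsClique A) : Q.rank A = I.ncard := by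
  refine IsGreatest.csSup_eq ⟨mem_image_of_mem _ ⟨hI.subset, hI.indep⟩, ?_⟩
  rintro _ ⟨J, hJ, rfl⟩
  refine ENat.toNat_le_toNat ?_ (hI.indep.finite (hA.subset hI.subset)).encard_lt_top.ne
  rw [((hA.matroid_isBasis_iff subset_rfl).2 hI).encard_eq_eRk]
  exact Matroid.Indep.encard_le_eRk_of_subset (M := hA.matroid) hJ hJ.1

theorem rank_mono {S T : Set P} (hT : Q.IsClique T) (hST : S ⊆ T) :
    Q.rank S ≤ Q.rank T := by
  obtain ⟨I, J, hI, hJ, hIJ⟩ := hT.exists_isBasis_subset_isBasis hST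
  rw [hI.rank_eq_ncard (hT.subset hST), hJ.rank_eq_ncard hT]
  exact ncard_le_ncard hIJ (hJ.indep.finite (hT.subset hJ.subset))

theorem rank_span {A : Set P} (hA : Q.IsClique A) :
    Q.rank (Q.span A) = Q.rank A := by
  obtain ⟨I, hI⟩ := hA.exists_isBasis
  have hspan : Q.IsBasis I (Q.span A) :=
    ⟨hI.subset.trans (subset_span A), hI.indep, hI.span_eq.ge⟩
  rw [hI.rank_eq_ncard hA, hspan.rank_eq_ncard hA.isSingular_span.isClique]

theorem rank_insert {A : Set P} {x : P} (hA : Q.IsClique (insert x A))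
    (hx : x ∉ Q.span A) : Q.rank (insert x A) = Q.rank A + 1 := by
  have hA' := hA.subset (subset_insert x A)
  obtain ⟨I, hI⟩ := hA'.exists_isBasis
  rw [(hI.insert hA hx).rank_eq_ncard hA, hI.rank_eq_ncard hA', ncard_insert_of_notMem
    (fun hxI => hx (subset_span A (hI.subset hxI))) (hI.indep.finite (hA'.subset hI.subset))]

theorem rank_empty : Q.rank ∅ = 0 := by
  rw [isBasis_empty.rank_eq_ncard isSingular_empty.isClique, ncard_empty]

theorem rank_singleton (p : P) : Q.rank {p} = 1 := by
  have hp := rank_insert (Q := Q) (A := ∅) (x := p) (by simpa using isClique_singleton p)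
    (by simp [isSingular_empty.1.span_eq])
  simpa [rank_empty] using hp

theorem IsSingular.hasDim_iff {S : Set P} (hS : Q.IsSingular S) {k : ℤ} :
    Q.HasDim S k ↔ (Q.rank S : ℤ) = k + 1 := by
  constructor
  · rintro ⟨I, -, hk, hI, rfl⟩
    have hbasis : Q.IsBasis I (Q.span I) := ⟨subset_span I, hI, subset_rfl⟩
    rw [hbasis.rank_eq_ncard hS.isClique, hk]
  · intro hk
    obtain ⟨I, hI⟩ := hS.isClique.exists_isBasis
    exact ⟨I, hI.indep.finite (hS.isClique.subset hI.subset),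
      by rw [← hI.rank_eq_ncard hS.isClique, hk], hI.indep, hI.span_eq.trans hS.1.span_eq⟩

theorem IsSingular.eq_of_subset_of_rank_le {S T : Set P} (hS : Q.IsSingular S)
    (hT : Q.IsClique T) (hST : S ⊆ T) (hr : Q.rank T ≤ Q.rank S) : S = T := by
  obtain ⟨I, J, hI, hJ, hIJ⟩ := hT.exists_isBasis_subset_isBasis hST
  rw [hI.rank_eq_ncard hS.isClique, hJ.rank_eq_ncard hT] at hr
  rw [← eq_of_subset_of_ncard_le hIJ hr (hJ.indep.finite (hT.subset hJ.subset))] at hJ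
  exact hST.antisymm (hJ.subset_span.trans (hI.span_eq.trans hS.1.span_eq).le)

end IsShultSpace

section IsShultSpace

variable [Q.IsShultSpace]

theorem rank_lt_of_ssubset {S T : Set P} (hS : Q.IsSingular S) (hT : Q.IsClique T)
    (hST : S ⊂ T) : Q.rank S < Q.rank T := by
  by_contra! hr
  exact hST.ne (hS.eq_of_subset_of_rank_le hT hST.subset hr)

theorem rank_span_insert {S : Set P} (hS : Q.IsSingular S) {x : P} (hx : x ∈ Q.perp S)
    (hxS : x ∉ S) : Q.rank (Q.span (insert x S)) = Q.rank S + 1 := by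
  have hclique := hS.isClique.insert hx
  rw [rank_span hclique, rank_insert hclique (hS.1.span_eq.symm ▸ hxS)]

theorem rank_le_rank_inter_perp_singleton {S : Set P} (hS : Q.IsSingular S) (p : P) :
    Q.rank S ≤ Q.rank (S ∩ Q.perp {p}) + 1 := by
  have hH : Q.IsSingular (S ∩ Q.perp {p}) := hS.inter (isSubspace_perp {p})
  by_cases hSH : S ⊆ S ∩ Q.perp {p}
  · exact (rank_mono hH.isClique hSH).trans (Nat.le_succ _)
  obtain ⟨x, hx, hxH⟩ := not_subset.1 hSH
  have hxp : x ∈ Q.perp (S ∩ Q.perp {p}) := fun a ha => hS.2 x hx a ha.1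
  rw [← rank_span_insert hH hxp hxH]
  refine rank_mono (hH.isClique.insert hxp).isSingular_span.isClique fun y hy => ?_
  by_cases hyx : y = x
  · rw [hyx]
    exact mem_span_insert x _
  obtain ⟨L, hL, hyL, hxL⟩ := hS.2 y hy x hx
  obtain ⟨w, hwL, hpw⟩ := exists_mem_line_coll p hL
  have hw : w ∈ S ∩ Q.perp {p} :=
    ⟨hS.1 y hy x hx hyx L hL hyL hxL hwL, mem_perp_singleton.2 hpw.symm⟩
  have hwx : w ≠ x := by rintro rfl; exact hxH hw
  exact isSubspace_span _ w (subset_span_insert x _ hw) x (mem_span_insert x _) hwx L hL hwL hxL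
    hyL

/-- The nontrivial half of the modular law in the projective space `U`. -/
theorem rank_add_rank_le {S T U : Set P} (hS : Q.IsSingular S) (hT : Q.IsSingular T)
    (hU : Q.IsSingular U) (hSU : S ⊆ U) (hTU : T ⊆ U) :
    Q.rank S + Q.rank T ≤ Q.rank (S ∩ T) + Q.rank U := by
  obtain ⟨d, hd⟩ : ∃ d, Q.rank U = Q.rank S + d :=
    Nat.exists_eq_add_of_le (rank_mono hU.isClique hSU)
  induction d generalizing T U with
  | zero =>
    rw [hS.eq_of_subset_of_rank_le hU.isClique hSU hd.le, inter_eq_right.2 hTU, add_comm]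
  | succ d ih =>
    obtain ⟨x, hxU, hxS⟩ : ∃ x ∈ U, x ∉ S :=
      not_subset.1 fun hUS => by have := rank_mono hS.isClique hUS; omega
    obtain ⟨q, hq, hxq⟩ := hS.exists_mem_perp_not_coll hxS
    have hSq : S ⊆ Q.perp {q} := subset_perp_comm.1 (singleton_subset_iff.2 hq)
    have hUq := hU.inter (isSubspace_perp {q})
    have hUlt := rank_lt_of_ssubset hUq hU.isClique
      ⟨inter_subset_left, fun hsub => hxq (mem_perp_singleton.1 (hsub hxU).2)⟩
    have hUle := rank_le_rank_inter_perp_singleton hU q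
    have hTle := rank_le_rank_inter_perp_singleton hT q
    have hmod := ih (hT.inter (isSubspace_perp {q})) hUq (subset_inter hSU hSq)
      (inter_subset_inter_left _ hTU) (by omega)
    have hST : S ∩ (T ∩ Q.perp {q}) = S ∩ T := by
      rw [inter_left_comm, inter_eq_left.2 hSq, inter_comm]
    rw [hST] at hmod
    omega

theorem rank_add_rank_inter_le {M X : Set P} (hM : Q.IsSingular M) (hX : Q.IsSingular X) :
    Q.rank M + Q.rank (X ∩ M) ≤ Q.rank (M ∩ Q.perp X) + Q.rank X := by
  have hbase : M ∩ Q.perp (X ∩ M) = M :=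
    inter_eq_left.2 (hM.isClique.trans (perp_anti inter_subset_right))
  obtain ⟨Y, -, ⟨hY, hYX, hr⟩, hmax⟩ := exists_maximal_of_isSingular
    (p := fun Y => Q.IsSingular Y ∧ Y ⊆ X ∧
      Q.rank M + Q.rank (X ∩ M) ≤ Q.rank (M ∩ Q.perp Y) + Q.rank Y)
    (fun _ hY => hY.1) ⟨hX.inter hM.1, inter_subset_left, by rw [hbase]⟩
  suffices hXY : X ⊆ Y by rwa [hYX.antisymm hXY] at hr
  intro x hx
  by_contra hxY
  have hxp : x ∈ Q.perp Y := fun a ha => hX.2 x hx a (hYX ha)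
  refine hxY (hmax ⟨(hY.isClique.insert hxp).isSingular_span,
    span_subset hX.1 (insert_subset hx hYX), ?_⟩ (subset_span_insert x Y) (mem_span_insert x Y))
  have hMx := rank_le_rank_inter_perp_singleton (hM.inter (isSubspace_perp Y)) x
  rw [rank_span_insert hY hxp hxY, perp_span, perp_insert, inter_comm (Q.perp {x}),
    ← inter_assoc]
  omega

/-! ### Generators -/

omit [Q.IsShultSpace] in
theorem maximal_isSingular_of_perp_subset {S : Set P} (hS : Q.IsSingular S)
    (hperp : Q.perp S ⊆ S) : Maximal Q.IsSingular S :=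
  ⟨hS, fun _ hT hST _ hx => hperp fun a ha => hT.2 _ hx a (hST ha)⟩

/-- A generator: a maximal singular subspace. -/
abbrev Generator (Q : PartialLinearSpace P) : Type u := {M : Set P // Maximal Q.IsSingular M}

namespace Generator

omit [Q.IsShultSpace] in
theorem isSingular (M : Q.Generator) : Q.IsSingular M.1 := M.2.1

omit [Q.IsShultSpace] in
theorem eq_of_subset {M : Q.Generator} {S : Set P} (hS : Q.IsSingular S) (h : M.1 ⊆ S) :
    M.1 = S :=
  h.antisymm (M.2.2 hS h)

theorem perp_subset (M : Q.Generator) : Q.perp M.1 ⊆ M.1 := fun x hx =>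
  M.2.2 (M.isSingular.isClique.insert hx).isSingular_span (subset_span_insert x M.1)
    (mem_span_insert x M.1)

end Generator

theorem IsClique.exists_generator_superset {A : Set P} (hA : Q.IsClique A) :
    ∃ M : Q.Generator, A ⊆ M.1 := by
  obtain ⟨M, hAM, hM⟩ := exists_maximal_of_isSingular (fun _ hS => hS) hA.isSingular_span
  exact ⟨⟨M, hM⟩, (subset_span A).trans hAM⟩

theorem IsSingular.exists_generator_superset_notMem {S : Set P} (hS : Q.IsSingular S) {p : P}
    (hp : p ∉ S) : ∃ M : Q.Generator, S ⊆ M.1 ∧ p ∉ M.1 := by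
  obtain ⟨q, hq, hpq⟩ := hS.exists_mem_perp_not_coll hp
  obtain ⟨M, hM⟩ := (hS.isClique.insert hq).exists_generator_superset
  exact ⟨M, (subset_insert q S).trans hM,
    fun hpM => hpq (M.isSingular.isClique hpM q (hM (mem_insert q S)))⟩

theorem IsSingular.exists_generator_inter_eq {S : Set P} (hS : Q.IsSingular S)
    (N : Q.Generator) : ∃ M : Q.Generator, S ⊆ M.1 ∧ M.1 ∩ N.1 = S ∩ N.1 := by
  obtain ⟨M, -, ⟨hM, hSM, hMN⟩, hmax⟩ := exists_maximal_of_isSingular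
    (p := fun M => Q.IsSingular M ∧ S ⊆ M ∧ M ∩ N.1 = S ∩ N.1) (fun _ hM => hM.1)
    ⟨hS, subset_rfl, rfl⟩
  have hT : Q.IsSingular (Q.span (M ∪ (N.1 ∩ Q.perp M))) :=
    (hM.isClique.union (N.isSingular.isClique.subset inter_subset_left)
      inter_subset_right).isSingular_span
  have hperp : Q.perp M ⊆ Q.span (M ∪ (N.1 ∩ Q.perp M)) := by
    intro x hx
    by_contra hxT
    have hxM : x ∉ M := fun hxM => hxT (subset_span _ (.inl hxM))
    have hclique := hM.isClique.insert hx
    have hspan : Q.span (insert x M) ∩ N.1 = S ∩ N.1 := by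
      rw [← hMN]
      refine subset_antisymm (fun y hy => ⟨?_, hy.2⟩)
        (inter_subset_inter_left _ (subset_span_insert x M))
      by_contra hyM
      have hyp : y ∈ Q.perp M :=
        perp_anti (subset_span_insert x M) (hclique.isSingular_span.isClique hy.1)
      exact hxT (span_mono (insert_subset (.inr ⟨hy.2, hyp⟩) subset_union_left)
        (hclique.mem_span_insert_exchange hy.1 (hM.1.span_eq.symm ▸ hyM)))
    exact hxM (hmax ⟨hclique.isSingular_span, hSM.trans (subset_span_insert x M), hspan⟩
      (subset_span_insert x M) (mem_span_insert x M))
  refine ⟨⟨M, maximal_isSingular_of_perp_subset hM fun x hx => ?_⟩, hSM, hMN⟩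
  have hxperp : x ∈ Q.perp (Q.perp M) := fun y hy => hT.2 x (hperp hx) y (hperp hy)
  rwa [← hM.isClique.span_eq_perp_perp, hM.1.span_eq] at hxperp

end IsShultSpace

/-- The singular subspaces of dimension `n - 2`, that is, of rank `n - 1`. -/
abbrev Submaximal (Q : PartialLinearSpace P) (n : ℕ) : Type u := Q.Grassmannian ((n : ℤ) - 2)

/-- The Grassmann graph on the singular subspaces of dimension `n - 2`. -/
abbrev submaximalGraph (Q : PartialLinearSpace P) (n : ℕ) : SimpleGraph (Q.Submaximal n) :=
  Q.grassmannGraph ((n : ℤ) - 2)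

theorem Submaximal.isSingular (X : Q.Submaximal n) : Q.IsSingular X.1 := X.2.1

section IsShultSpaceOfRank

variable [Q.IsShultSpaceOfRank n]

theorem Generator.rank_eq (M : Q.Generator) : Q.rank M.1 = n := by
  have := M.isSingular.hasDim_iff.1 (IsShultSpaceOfRank.dim_maximal M.1 M.2)
  omega

theorem IsClique.rank_le {A : Set P} (hA : Q.IsClique A) : Q.rank A ≤ n := by
  obtain ⟨M, hM⟩ := hA.exists_generator_superset
  exact M.rank_eq ▸ rank_mono M.isSingular.isClique hM

theorem IsSingular.maximal_iff_rank_eq {S : Set P} (hS : Q.IsSingular S) :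
    Maximal Q.IsSingular S ↔ Q.rank S = n := by
  refine ⟨fun hmax => Generator.rank_eq ⟨S, hmax⟩, fun hr => ?_⟩
  obtain ⟨M, hM⟩ := hS.isClique.exists_generator_superset
  rw [hS.eq_of_subset_of_rank_le M.isSingular.isClique hM (by rw [M.rank_eq, hr])]
  exact M.2

theorem Generator.eq_of_le_rank_inter {M N : Q.Generator} (h : n ≤ Q.rank (M.1 ∩ N.1)) :
    M = N := by
  have hMN := (M.isSingular.inter N.isSingular.1).eq_of_subset_of_rank_le
    M.isSingular.isClique inter_subset_left (by rwa [M.rank_eq])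
  exact Subtype.ext (Generator.eq_of_subset N.isSingular (inter_eq_left.1 hMN))

theorem Submaximal.rank_add_one (X : Q.Submaximal n) : Q.rank X.1 + 1 = n := by
  have := X.isSingular.hasDim_iff.1 X.2.2
  omega

/-- A singular subspace of rank `n - 1` as a vertex of the Grassmann graph. -/
def Submaximal.ofRank {S : Set P} (hS : Q.IsSingular S) (hr : Q.rank S + 1 = n) :
    Q.Submaximal n :=
  ⟨S, hS, hS.hasDim_iff.2 (by omega)⟩

theorem Submaximal.eq_of_subset {X : Q.Submaximal n} {S : Set P} (hS : Q.IsClique S)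
    (hXS : X.1 ⊆ S) (hr : Q.rank S < n) : X.1 = S :=
  X.isSingular.eq_of_subset_of_rank_le hS hXS (by have := X.rank_add_one; omega)

/-- The hyperplane that the perp of a point `x` outside a generator `M` cuts out in `M`. -/
def Generator.interPerp (M : Q.Generator) {x : P} (hx : x ∉ M.1) : Q.Submaximal n :=
  .ofRank (M.isSingular.inter (isSubspace_perp {x})) <| by
    have hle := rank_le_rank_inter_perp_singleton M.isSingular x
    have hlt := rank_lt_of_ssubset (M.isSingular.inter (isSubspace_perp {x}))
      M.isSingular.isClique ⟨inter_subset_left, fun hsub => hx <| M.perp_subset <|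
        singleton_subset_iff.1 <| subset_perp_comm.1 (hsub.trans inter_subset_right)⟩
    rw [M.rank_eq] at hle hlt
    omega

/-- The generator spanned by a submaximal subspace `X` and a point outside `X` collinear to all
of `X`. -/
def Submaximal.join (X : Q.Submaximal n) {x : P} (hx : x ∈ Q.perp X.1) (hxX : x ∉ X.1) :
    Q.Generator :=
  ⟨Q.span (insert x X.1), (X.isSingular.isClique.insert hx).isSingular_span.maximal_iff_rank_eq.2
    (by rw [rank_span_insert X.isSingular hx hxX, X.rank_add_one])⟩

theorem Submaximal.subset_join (X : Q.Submaximal n) {x : P} (hx : x ∈ Q.perp X.1)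
    (hxX : x ∉ X.1) : X.1 ⊆ (X.join hx hxX).1 :=
  subset_span_insert x X.1

theorem Submaximal.mem_join (X : Q.Submaximal n) {x : P} (hx : x ∈ Q.perp X.1)
    (hxX : x ∉ X.1) : x ∈ (X.join hx hxX).1 :=
  mem_span_insert x X.1

theorem Generator.exists_submaximal_notMem (M : Q.Generator) {S : Set P} (hS : Q.IsSingular S)
    (hSM : S ⊆ M.1) {u : P} (huM : u ∈ M.1) (hu : u ∉ S) :
    ∃ X : Q.Submaximal n, S ⊆ X.1 ∧ X.1 ⊆ M.1 ∧ u ∉ X.1 := by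
  obtain ⟨q, hq, huq⟩ := hS.exists_mem_perp_not_coll hu
  have hqM : q ∉ M.1 := fun hqM => huq (M.isSingular.isClique huM q hqM)
  exact ⟨M.interPerp hqM,
    subset_inter hSM (subset_perp_comm.1 (singleton_subset_iff.2 hq)), inter_subset_left,
    fun hmem => huq (mem_perp_singleton.1 hmem.2)⟩

theorem Submaximal.inter_eq (X : Q.Submaximal n) {M N : Q.Generator} (hXM : X.1 ⊆ M.1)
    (hXN : X.1 ⊆ N.1) (hMN : M ≠ N) : M.1 ∩ N.1 = X.1 :=
  (X.eq_of_subset (M.isSingular.isClique.subset inter_subset_left) (subset_inter hXM hXN)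
    (not_le.1 fun hr => hMN (Generator.eq_of_le_rank_inter hr))).symm

theorem Submaximal.rank_le_rank_inter (X : Q.Submaximal n) {M : Q.Generator} (hXM : X.1 ⊆ M.1)
    {S : Set P} (hS : Q.IsSingular S) (hSM : S ⊆ M.1) : Q.rank S ≤ Q.rank (S ∩ X.1) + 1 := by
  have hmod := rank_add_rank_le hS X.isSingular M.isSingular hSM hXM
  have hX := X.rank_add_one
  rw [M.rank_eq] at hmod
  omega

theorem Submaximal.mem_of_mem_perp (X : Q.Submaximal n) {M : Q.Generator} (hXM : X.1 ⊆ M.1)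
    {p z : P} (hp : p ∈ M.1) (hpX : p ∉ X.1) (hz : z ∈ Q.perp X.1) (hzp : Q.Coll z p) :
    z ∈ M.1 := by
  have hpp : p ∈ Q.perp X.1 := perp_anti hXM (M.isSingular.isClique hp)
  have hjoin : (X.join hpp hpX).1 = M.1 := Generator.eq_of_subset M.isSingular
    (span_subset M.isSingular.1 (insert_subset hp hXM))
  rw [← hjoin]
  refine (X.join hpp hpX).perp_subset ?_
  rw [join, perp_span, perp_insert]
  exact ⟨mem_perp_singleton.2 hzp, hz⟩

theorem Submaximal.exists_generator_rank_inter_lt (X : Q.Submaximal n) (N : Q.Generator) :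
    ∃ M : Q.Generator, X.1 ⊆ M.1 ∧ Q.rank (X.1 ∩ N.1) < Q.rank (M.1 ∩ N.1) := by
  have hrank := rank_add_rank_inter_le N.isSingular X.isSingular
  have hX := X.rank_add_one
  rw [N.rank_eq] at hrank
  obtain ⟨x, ⟨hxN, hxp⟩, hxX⟩ : ∃ x ∈ N.1 ∩ Q.perp X.1, x ∉ X.1 := by
    by_contra! hsub
    have := rank_mono (X.isSingular.isClique.subset inter_subset_left)
      (fun x hx => ⟨hsub x hx, hx.1⟩ : N.1 ∩ Q.perp X.1 ⊆ X.1 ∩ N.1)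
    omega
  refine ⟨X.join hxp hxX, X.subset_join hxp hxX, rank_lt_of_ssubset
    (X.isSingular.inter N.isSingular.1) (N.isSingular.isClique.subset inter_subset_right)
    ⟨inter_subset_inter_left _ (X.subset_join hxp hxX), fun hsub => ?_⟩⟩
  exact hxX (hsub ⟨X.mem_join hxp hxX, hxN⟩).1

/-- Induction along a gallery towards `N`: consecutive generators share a hyperplane, and each step
enlarges the intersection with `N`. -/
theorem Generator.gallery_induction {N : Q.Generator} {C : Q.Generator → Prop} (base : C N)
    (step : ∀ (M M' : Q.Generator) (X : Q.Submaximal n), X.1 ⊆ M.1 → X.1 ⊆ M'.1 →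
      M.1 ∩ N.1 ⊆ X.1 → Q.rank (M.1 ∩ N.1) < Q.rank (M'.1 ∩ N.1) → C M' → C M)
    (M : Q.Generator) : C M := by
  induction hk : n - Q.rank (M.1 ∩ N.1) using Nat.strong_induction_on generalizing M with
  | _ k ih =>
  by_cases hMN : M = N
  · exact hMN ▸ base
  obtain ⟨u, huM, huN⟩ : ∃ u ∈ M.1, u ∉ N.1 :=
    not_subset.1 fun hsub => hMN (Subtype.ext (eq_of_subset N.isSingular hsub))
  obtain ⟨X, hX, hXM, -⟩ := M.exists_submaximal_notMem (M.isSingular.inter N.isSingular.1)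
    inter_subset_left huM fun hu => huN hu.2
  obtain ⟨M', hXM', hlt⟩ := X.exists_generator_rank_inter_lt N
  have hXN : X.1 ∩ N.1 = M.1 ∩ N.1 :=
    (inter_subset_inter_left _ hXM).antisymm (subset_inter hX inter_subset_right)
  rw [hXN] at hlt
  have hle := (M'.isSingular.isClique.subset (inter_subset_left (t := N.1))).rank_le
  exact step M M' X hXM hXM' hX hlt (ih _ (by omega) M' rfl)

end IsShultSpaceOfRank

/-! ### Distances in the Grassmann graph -/

section IsShultSpace

variable [Q.IsShultSpace]

theorem nonempty_of_rank_pos {A : Set P} (h : 0 < Q.rank A) : A.Nonempty := by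
  rw [nonempty_iff_ne_empty]
  rintro rfl
  exact h.ne' rank_empty

theorem IsClique.rank_pos {A : Set P} (hA : Q.IsClique A) {p : P} (hp : p ∈ A) : 0 < Q.rank A :=
  Nat.lt_of_lt_of_le (rank_singleton p).ge (rank_mono hA (singleton_subset_iff.2 hp))

theorem IsClique.eq_of_rank_le_one {A : Set P} (hA : Q.IsClique A) (hr : Q.rank A ≤ 1) {p q : P}
    (hp : p ∈ A) (hq : q ∈ A) : p = q := by
  have hpA := (isSingular_singleton p).eq_of_subset_of_rank_le hA (singleton_subset_iff.2 hp)
    (by rwa [rank_singleton])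
  exact (hpA.symm.subset hq).symm

theorem exists_mem_ne_of_two_le_rank {A : Set P} (h : 2 ≤ Q.rank A) (p : P) :
    ∃ q ∈ A, q ≠ p := by
  by_contra! hA
  have hle := rank_mono (Q := Q) (isClique_singleton p) (fun q hq => hA q hq : A ⊆ {p})
  rw [rank_singleton] at hle
  omega

end IsShultSpace

theorem two_le_of_isShultSpaceOfRank (Q : PartialLinearSpace P) [Q.IsShultSpaceOfRank n] :
    2 ≤ n := by
  obtain ⟨p⟩ := Q.nonempty
  obtain ⟨L, hL, hpL⟩ := Q.exists_line p
  obtain ⟨q, hqL, hqp⟩ := (Q.line_nontrivial L hL).exists_ne p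
  have hclique : Q.IsClique {q, p} :=
    (isClique_singleton p).insert (mem_perp_singleton.2 ⟨L, hL, hqL, hpL⟩)
  have hrank := rank_insert hclique (by rwa [(isSingular_singleton p).1.span_eq])
  rw [rank_singleton] at hrank
  exact hrank.ge.trans hclique.rank_le

section IsShultSpaceOfRank

variable [Q.IsShultSpaceOfRank n]

theorem exists_generator_of_adj {X Y : Q.Submaximal n} (hXY : (Q.submaximalGraph n).Adj X Y) :
    ∃ M : Q.Generator, X.1 ⊆ M.1 ∧ Y.1 ⊆ M.1 := by
  obtain ⟨-, U, hU, hdim, hX, hY⟩ := hXY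
  have hrank := hU.hasDim_iff.1 hdim
  exact ⟨⟨U, hU.maximal_iff_rank_eq.2 (by omega)⟩, hX, hY⟩

theorem edist_le_one_of_subset {X Y : Q.Submaximal n} {M : Q.Generator} (hX : X.1 ⊆ M.1)
    (hY : Y.1 ⊆ M.1) : (Q.submaximalGraph n).edist X Y ≤ 1 := by
  rw [SimpleGraph.edist_le_one_iff_adj_or_eq]
  refine or_iff_not_imp_right.2 fun hne => ⟨hne, M.1, M.isSingular, ?_, hX, hY⟩
  rw [M.isSingular.hasDim_iff, M.rank_eq]
  ring

theorem exists_generators_of_walk {X Y : Q.Submaximal n} (w : (Q.submaximalGraph n).Walk X Y)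
    {k : ℕ} (hk : w.length ≤ k + 1) :
    ∃ M N : Q.Generator, X.1 ⊆ M.1 ∧ Y.1 ⊆ N.1 ∧ n ≤ Q.rank (M.1 ∩ N.1) + k := by
  have hdiag (M : Q.Generator) (k : ℕ) : n ≤ Q.rank (M.1 ∩ M.1) + k := by
    rw [inter_self, M.rank_eq]
    exact Nat.le_add_right n k
  induction w generalizing k with
  | @nil X =>
    obtain ⟨M, hM⟩ := X.isSingular.isClique.exists_generator_superset
    exact ⟨M, M, hM, hM, hdiag M k⟩
  | @cons X Z Y hXZ w ih =>
    obtain ⟨M, hXM, hZM⟩ := exists_generator_of_adj hXZ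
    rw [SimpleGraph.Walk.length_cons] at hk
    cases k with
    | zero =>
      obtain rfl := SimpleGraph.Walk.eq_of_length_eq_zero (by omega : w.length = 0)
      exact ⟨M, M, hXM, hZM, hdiag M 0⟩
    | succ k =>
      obtain ⟨M', N, hZM', hYN, hr⟩ := ih (by omega : w.length ≤ k + 1)
      refine ⟨M, N, hXM, hYN, ?_⟩
      have hdrop := Z.rank_le_rank_inter hZM' (M'.isSingular.inter N.isSingular.1)
        inter_subset_left
      have hmono := rank_mono (M.isSingular.isClique.subset inter_subset_left)
        (fun x hx => ⟨hZM hx.2, hx.1.2⟩ : M'.1 ∩ N.1 ∩ Z.1 ⊆ M.1 ∩ N.1)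
      omega

theorem edist_le_succ_of_le_rank_inter {N : Q.Generator} {Y : Q.Submaximal n} (hY : Y.1 ⊆ N.1)
    (M : Q.Generator) {X : Q.Submaximal n} (hX : X.1 ⊆ M.1) {k : ℕ}
    (hk : n ≤ Q.rank (M.1 ∩ N.1) + k) : (Q.submaximalGraph n).edist X Y ≤ (k + 1 : ℕ) := by
  induction M using Generator.gallery_induction (N := N) generalizing X k with
  | base => exact (edist_le_one_of_subset hX hY).trans (by exact_mod_cast Nat.le_add_left 1 k)
  | step M M' Z hZM hZM' _ hlt ih =>
    have hle := (M'.isSingular.isClique.subset (inter_subset_left (t := N.1))).rank_le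
    obtain ⟨k, rfl⟩ : ∃ m, k = m + 1 := Nat.exists_eq_add_of_lt (by omega : 0 < k) |>.imp
      fun m hm => by omega
    calc (Q.submaximalGraph n).edist X Y
        ≤ (Q.submaximalGraph n).edist X Z + (Q.submaximalGraph n).edist Z Y :=
          SimpleGraph.edist_triangle
      _ ≤ 1 + (k + 1 : ℕ) := add_le_add (edist_le_one_of_subset hX hZM) (ih hZM' (by omega))
      _ = (k + 1 + 1 : ℕ) := by push_cast; ring

theorem edist_le_succ_iff {X Y : Q.Submaximal n} {k : ℕ} :
    (Q.submaximalGraph n).edist X Y ≤ (k + 1 : ℕ) ↔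
      ∃ M N : Q.Generator, X.1 ⊆ M.1 ∧ Y.1 ⊆ N.1 ∧ n ≤ Q.rank (M.1 ∩ N.1) + k := by
  constructor
  · intro hk
    obtain ⟨w, hw⟩ := SimpleGraph.exists_walk_of_edist_ne_top
      (ne_top_of_le_ne_top (ENat.natCast_ne_top _) hk)
    exact exists_generators_of_walk w (by exact_mod_cast hw.le.trans hk)
  · rintro ⟨M, N, hX, hY, hk⟩
    exact edist_le_succ_of_le_rank_inter hY M hX hk

theorem edist_lt_of_mem {X Y : Q.Submaximal n} {p : P} (hpX : p ∈ X.1) (hpY : p ∈ Y.1) :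
    (Q.submaximalGraph n).edist X Y < n := by
  obtain ⟨N, hYN⟩ := Y.isSingular.isClique.exists_generator_superset
  obtain ⟨M, hXM, hlt⟩ := X.exists_generator_rank_inter_lt N
  have hpos := (X.isSingular.isClique.subset inter_subset_left).rank_pos
    (⟨hpX, hYN hpY⟩ : p ∈ X.1 ∩ N.1)
  have hn := two_le_of_isShultSpaceOfRank Q
  have hle : (Q.submaximalGraph n).edist X Y ≤ (n - 2 + 1 : ℕ) :=
    edist_le_succ_iff.2 ⟨M, N, hXM, hYN, by omega⟩
  exact hle.trans_lt (by exact_mod_cast (by omega : n - 2 + 1 < n))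

theorem le_edist_of_disjoint_perp {X Y : Q.Submaximal n} (h : Disjoint Y.1 (Q.perp X.1)) :
    n ≤ (Q.submaximalGraph n).edist X Y := by
  obtain ⟨k, rfl⟩ := Nat.exists_eq_add_of_le' (two_le_of_isShultSpaceOfRank Q)
  by_contra! hlt
  obtain ⟨M, N, hXM, hYN, hr⟩ := edist_le_succ_iff.1
    (ENat.lt_natCast_add_one_iff.1 (by exact_mod_cast hlt) :
      (Q.submaximalGraph (k + 2)).edist X Y ≤ (k + 1 : ℕ))
  have hdrop := Y.rank_le_rank_inter hYN (M.isSingular.inter N.isSingular.1) inter_subset_right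
  obtain ⟨x, ⟨hxM, -⟩, hxY⟩ := nonempty_of_rank_pos (by omega : 0 < Q.rank (M.1 ∩ N.1 ∩ Y.1))
  exact h.notMem_of_mem_left hxY (perp_anti hXM (M.isSingular.isClique hxM))

/-! ### Hyperplanes through and off a point -/

theorem Generator.exists_submaximal_inter_eq_singleton (M : Q.Generator) {S : Set P}
    (hS : Q.IsSingular S) (hSM : S ⊆ M.1) (hr : Q.rank S ≤ 2) {p : P} (hp : p ∈ S) :
    ∃ X : Q.Submaximal n, X.1 ⊆ M.1 ∧ S ∩ X.1 = {p} := by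
  obtain ⟨u, huM, hup, hu⟩ : ∃ u ∈ M.1, u ≠ p ∧ (u ∈ S ∨ S ⊆ {p}) := by
    by_cases hsub : S ⊆ {p}
    · obtain ⟨u, huM, hup⟩ :=
        exists_mem_ne_of_two_le_rank (M.rank_eq.symm ▸ two_le_of_isShultSpaceOfRank Q) p
      exact ⟨u, huM, hup, .inr hsub⟩
    · obtain ⟨u, huS, hup⟩ := not_subset.1 hsub
      exact ⟨u, hSM huS, hup, .inl huS⟩
  obtain ⟨X, hpX, hXM, huX⟩ := M.exists_submaximal_notMem (isSingular_singleton p)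
    (singleton_subset_iff.2 (hSM hp)) huM hup
  rw [singleton_subset_iff] at hpX
  refine ⟨X, hXM, subset_antisymm ?_ (singleton_subset_iff.2 ⟨hp, hpX⟩)⟩
  rcases hu with huS | hsub
  · have hlt := rank_lt_of_ssubset (hS.inter X.isSingular.1) hS.isClique
      ⟨inter_subset_left, fun hsub => huX (hsub huS).2⟩
    exact fun q hq => (hS.isClique.subset inter_subset_left).eq_of_rank_le_one (by omega) hq
      (⟨hp, hpX⟩ : p ∈ S ∩ X.1)
  · exact inter_subset_left.trans hsub

theorem IsSingular.exists_submaximal_superset {S : Set P} (hS : Q.IsSingular S)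
    (hr : Q.rank S < n) : ∃ X : Q.Submaximal n, S ⊆ X.1 := by
  obtain ⟨M, hSM⟩ := hS.isClique.exists_generator_superset
  obtain ⟨u, huM, huS⟩ := not_subset.1 fun hMS : M.1 ⊆ S =>
    (M.rank_eq ▸ rank_mono hS.isClique hMS).not_gt hr
  obtain ⟨X, hSX, -⟩ := M.exists_submaximal_notMem hS hSM huM huS
  exact ⟨X, hSX⟩

theorem exists_submaximal_mem_notMem_perp (hn : 3 ≤ n) {p q : P} (hqp : q ≠ p) :
    ∃ X : Q.Submaximal n, p ∈ X.1 ∧ q ∉ Q.perp X.1 := by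
  obtain ⟨c, hc, hqc⟩ := (isSingular_singleton (Q := Q) p).exists_mem_perp_not_coll hqp
  have hclique := (isClique_singleton p).insert hc
  have hrank : Q.rank (Q.span {c, p}) ≤ 2 := by
    by_cases hcp : c ∈ ({p} : Set P)
    · rw [rank_span hclique, insert_eq_of_mem hcp, rank_singleton]
      exact Nat.le_succ 1
    · rw [rank_span_insert (isSingular_singleton p) hc hcp, rank_singleton]
  obtain ⟨X, hX⟩ := hclique.isSingular_span.exists_submaximal_superset (by omega)
  exact ⟨X, hX (subset_span_insert c {p} rfl), fun hq => hqc (hq c (hX (mem_span_insert c {p})))⟩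

theorem exists_submaximal_mem_disjoint_perp {X : Q.Submaximal n} {p : P} (hp : p ∉ Q.perp X.1) :
    ∃ Y : Q.Submaximal n, p ∈ Y.1 ∧ Disjoint Y.1 (Q.perp X.1) := by
  obtain ⟨N, hXN⟩ := X.isSingular.isClique.exists_generator_superset
  have hpN : p ∉ N.1 := fun hpN => hp (perp_anti hXN (N.isSingular.isClique hpN))
  obtain ⟨M, hpM, hMN⟩ := (isSingular_singleton p).exists_generator_inter_eq N
  rw [singleton_inter_eq_empty.2 hpN] at hMN
  rw [singleton_subset_iff] at hpM
  have hT : Q.IsSingular (M.1 ∩ Q.perp X.1) := M.isSingular.inter (isSubspace_perp X.1)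
  have hrT : Q.rank (M.1 ∩ Q.perp X.1) ≤ 1 := by
    obtain ⟨U, hU⟩ :=
      (X.isSingular.isClique.union hT.isClique inter_subset_right).exists_generator_superset
    have hmod := rank_add_rank_le hT X.isSingular U.isSingular (subset_union_right.trans hU)
      (subset_union_left.trans hU)
    have hTX : M.1 ∩ Q.perp X.1 ∩ X.1 = ∅ :=
      subset_empty_iff.1 fun x hx => hMN.subset ⟨hx.1.1, hXN hx.2⟩
    have hX := X.rank_add_one
    rw [hTX, rank_empty, U.rank_eq] at hmod
    omega
  have hpT : p ∈ Q.perp (M.1 ∩ Q.perp X.1) :=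
    perp_anti inter_subset_left (M.isSingular.isClique hpM)
  obtain ⟨Y, hYM, hY⟩ := M.exists_submaximal_inter_eq_singleton
    (hT.isClique.insert hpT).isSingular_span
    (span_subset M.isSingular.1 (insert_subset hpM inter_subset_left))
    (by rw [rank_span_insert hT hpT fun h => hp h.2]; omega) (mem_span_insert p _)
  refine ⟨Y, (hY.symm.subset rfl).2, disjoint_left.2 fun z hzY hzX => hp ?_⟩
  have hzp : z = p := hY.subset ⟨subset_span_insert p _ ⟨hYM hzY, hzX⟩, hzY⟩
  exact hzp ▸ hzX

theorem edist_le_succ_iff_of_notMem {M N : Q.Generator} {p : P} (hpM : p ∈ M.1) (hpN : p ∈ N.1)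
    {X Y : Q.Submaximal n} (hXM : X.1 ⊆ M.1) (hYN : Y.1 ⊆ N.1) (hpX : p ∉ X.1) (hpY : p ∉ Y.1)
    {k : ℕ} : (Q.submaximalGraph n).edist X Y ≤ (k + 1 : ℕ) ↔ n ≤ Q.rank (M.1 ∩ N.1) + k := by
  refine ⟨fun hk => ?_, fun hk => edist_le_succ_iff.2 ⟨M, N, hXM, hYN, hk⟩⟩
  obtain ⟨M', N', hXM', hYN', hr⟩ := edist_le_succ_iff.1 hk
  have hdrop := Y.rank_le_rank_inter hYN' (M'.isSingular.inter N'.isSingular.1) inter_subset_right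
  have hsub : M'.1 ∩ N'.1 ∩ Y.1 ⊆ M.1 ∩ N.1 := fun z hz =>
    ⟨X.mem_of_mem_perp hXM hpM hpX (perp_anti hXM' (M'.isSingular.isClique hz.1.1))
      (N.isSingular.isClique (hYN hz.2) p hpN), hYN hz.2⟩
  have hlt := rank_lt_of_ssubset
    ((M'.isSingular.inter N'.isSingular.1).inter Y.isSingular.1)
    (M.isSingular.isClique.subset inter_subset_left)
    ⟨hsub, fun h => hpY (h ⟨hpM, hpN⟩).2⟩
  omega

theorem exists_generator_inter_eq_singleton {N N' K : Q.Generator} {p : P}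
    (hNN' : N.1 ∩ N'.1 = {p}) {X : Q.Submaximal n} (hpX : p ∈ X.1) (hXN : X.1 ⊆ N.1)
    (hXK : X.1 ⊆ K.1) :
    ∃ (X' : Q.Submaximal n) (N'' : Q.Generator), p ∈ X'.1 ∧ X'.1 ⊆ N'.1 ∧ X'.1 ⊆ N''.1 ∧
      K.1 ∩ N''.1 = {p} := by
  have hKN' : Q.IsSingular (K.1 ∩ N'.1) := K.isSingular.inter N'.isSingular.1
  have hdrop := X.rank_le_rank_inter hXK hKN' inter_subset_left
  have hle : Q.rank (K.1 ∩ N'.1 ∩ X.1) ≤ Q.rank {p} := rank_mono (Q := Q)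
    (isClique_singleton p) fun z hz => hNN'.subset ⟨hXN hz.2, hz.1.2⟩
  rw [rank_singleton] at hle
  obtain ⟨X', hX'N', hX'⟩ := N'.exists_submaximal_inter_eq_singleton hKN' inter_subset_right
    (by omega) ⟨hXK hpX, (hNN'.symm.subset rfl).2⟩
  obtain ⟨N'', hX'N'', hN''⟩ := X'.isSingular.exists_generator_inter_eq K
  refine ⟨X', N'', (hX'.symm.subset rfl).2, hX'N', hX'N'', ?_⟩
  rw [inter_comm, hN'', ← hX', inter_assoc, inter_eq_right.2 hX'N', inter_comm]

end IsShultSpaceOfRank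

/-! ### The induced map on generators -/

/-- `F` maps generators to generators compatibly with the map `f` of their hyperplanes. -/
structure IsGeneratorMap (f : Q.Submaximal n → Q'.Submaximal n) (F : Q.Generator → Q'.Generator) :
    Prop where
  subset : ∀ {X M}, X.1 ⊆ M.1 → (f X).1 ⊆ (F M).1

/-- The map `f` is isometric for the Grassmann graphs, and `F` is compatible with it. -/
structure IsIsometricGeneratorMap (f : Q.Submaximal n → Q'.Submaximal n)
    (F : Q.Generator → Q'.Generator) : Prop extends IsGeneratorMap f F where
  edist_eq : ∀ X Y,
    (Q'.submaximalGraph n).edist (f X) (f Y) = (Q.submaximalGraph n).edist X Y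

/-- `φ` maps points to points compatibly with the map `F` of generators induced by the isometric
map `f`. -/
structure IsIsometricPointMap (f : Q.Submaximal n → Q'.Submaximal n)
    (F : Q.Generator → Q'.Generator) (φ : P → P') : Prop extends
    IsIsometricGeneratorMap f F where
  mem : ∀ {p M}, p ∈ M.1 → φ p ∈ (F M).1

section Maps

variable [Q.IsShultSpaceOfRank n] [Q'.IsShultSpaceOfRank n]
  {f : Q.Submaximal n → Q'.Submaximal n} {F : Q.Generator → Q'.Generator} {φ : P → P'}

omit [Q.IsShultSpaceOfRank n] in
theorem subset_perp_of_edist_le_one {X Y : Q'.Submaximal n}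
    (h : (Q'.submaximalGraph n).edist X Y ≤ 1) : X.1 ⊆ Q'.perp Y.1 := by
  obtain ⟨M, N, hXM, hYN, hr⟩ := (edist_le_succ_iff (k := 0)).1 (by simpa using h)
  obtain rfl := Generator.eq_of_le_rank_inter hr
  exact fun x hx => perp_anti hYN (M.isSingular.isClique (hXM hx))

theorem exists_isIsometricGeneratorMap (hf : ∀ X Y,
    (Q'.submaximalGraph n).edist (f X) (f Y) = (Q.submaximalGraph n).edist X Y) :
    ∃ F, IsIsometricGeneratorMap f F := by
  have hclique (M : Q.Generator) : Q'.IsClique (⋃ (X) (_ : X.1 ⊆ M.1), (f X).1) := by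
    simp only [IsClique, iUnion_subset_iff]
    intro X hX x hx y hy
    obtain ⟨Y, hY, hyY⟩ := mem_iUnion₂.1 hy
    exact subset_perp_of_edist_le_one ((hf X Y).trans_le (edist_le_one_of_subset hX hY)) hx y hyY
  choose F hF using fun M => (hclique M).exists_generator_superset
  exact ⟨F, ⟨fun {X M} hX => (subset_iUnion₂ (s := fun X (_ : X.1 ⊆ M.1) => (f X).1) X hX).trans
    (hF M)⟩, hf⟩

namespace IsGeneratorMap

theorem rank_inter_le (hF : IsGeneratorMap f F) (M N : Q.Generator) :
    Q.rank (M.1 ∩ N.1) ≤ Q'.rank ((F M).1 ∩ (F N).1) := by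
  induction M using Generator.gallery_induction (N := N) with
  | base => rw [inter_self, inter_self, N.rank_eq, (F N).rank_eq]
  | step M M' X hXM hXM' _ hlt ih =>
    have hdrop := (f X).rank_le_rank_inter (hF.subset hXM')
      ((F M').isSingular.inter (F N).isSingular.1) inter_subset_left
    have hmono := rank_mono ((F M).isSingular.isClique.subset inter_subset_left)
      (fun z hz => ⟨hF.subset hXM hz.2, hz.1.2⟩ :
        (F M').1 ∩ (F N).1 ∩ (f X).1 ⊆ (F M).1 ∩ (F N).1)
    omega

end IsGeneratorMap

namespace IsIsometricGeneratorMap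

omit [Q.IsShultSpaceOfRank n] [Q'.IsShultSpaceOfRank n] in
theorem map_injective (hF : IsIsometricGeneratorMap f F) : Function.Injective f := fun X Y h =>
  SimpleGraph.edist_eq_zero_iff.1 ((hF.edist_eq X Y).symm.trans (SimpleGraph.edist_eq_zero_iff.2 h))

theorem rank_inter_eq (hF : IsIsometricGeneratorMap f F) {M N : Q.Generator} {p : P}
    (hpM : p ∈ M.1) (hpN : p ∈ N.1) :
    Q'.rank ((F M).1 ∩ (F N).1) = Q.rank (M.1 ∩ N.1) := by
  refine le_antisymm ?_ (hF.rank_inter_le M N)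
  have hyperplane (M : Q.Generator) (hpM : p ∈ M.1) :
      ∃ X : Q.Submaximal n, X.1 ⊆ M.1 ∧ p ∉ X.1 := by
    obtain ⟨X, -, hX⟩ :=
      M.exists_submaximal_notMem isSingular_empty (empty_subset _) hpM (notMem_empty p)
    exact ⟨X, hX⟩
  obtain ⟨X, hXM, hpX⟩ := hyperplane M hpM
  obtain ⟨Y, hYN, hpY⟩ := hyperplane N hpN
  obtain ⟨k, hk⟩ := Nat.exists_eq_add_of_le
    ((F M).isSingular.isClique.subset (inter_subset_left (t := (F N).1))).rank_le
  have hle := edist_le_succ_of_le_rank_inter (hF.subset hYN) (F M) (hF.subset hXM) hk.le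
  rw [hF.edist_eq, edist_le_succ_iff_of_notMem hpM hpN hXM hYN hpX hpY] at hle
  omega

theorem inter_eq (hF : IsIsometricGeneratorMap f F) {M N : Q.Generator} (hMN : M ≠ N)
    {X : Q.Submaximal n} (hXM : X.1 ⊆ M.1) (hXN : X.1 ⊆ N.1) :
    (F M).1 ∩ (F N).1 = (f X).1 := by
  refine (f X).inter_eq (hF.subset hXM) (hF.subset hXN) fun heq => hMN ?_
  have hn := two_le_of_isShultSpaceOfRank Q
  have hX := X.rank_add_one
  obtain ⟨p, hp⟩ := nonempty_of_rank_pos (by omega : 0 < Q.rank X.1)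
  refine Generator.eq_of_le_rank_inter ?_
  rw [← hF.rank_inter_eq (hXM hp) (hXN hp), heq, inter_self, (F N).rank_eq]

theorem mem_of_inter_eq_singleton (hF : IsIsometricGeneratorMap f F) {N N' : Q.Generator} {p : P}
    (hNN' : N.1 ∩ N'.1 = {p}) {p' : P'} (hp' : p' ∈ (F N).1 ∩ (F N').1) {X : Q.Submaximal n}
    (hpX : p ∈ X.1) (hXN : X.1 ⊆ N.1) : p' ∈ (f X).1 := by
  obtain ⟨hpN, hpN'⟩ : p ∈ N.1 ∩ N'.1 := hNN'.symm.subset rfl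
  obtain ⟨U, hXU, hlt⟩ := X.exists_generator_rank_inter_lt N'
  have hpos := (X.isSingular.isClique.subset inter_subset_left).rank_pos
    (⟨hpX, hpN'⟩ : p ∈ X.1 ∩ N'.1)
  have hle := hF.rank_inter_le U N'
  have hdrop := (f X).rank_le_rank_inter (hF.subset hXU)
    ((F U).isSingular.inter (F N').isSingular.1) inter_subset_left
  obtain ⟨z, ⟨-, hzN'⟩, hzX⟩ := nonempty_of_rank_pos
    (by omega : 0 < Q'.rank ((F U).1 ∩ (F N').1 ∩ (f X).1))
  have hone : Q'.rank ((F N).1 ∩ (F N').1) = 1 := by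
    rw [hF.rank_inter_eq hpN hpN', hNN', rank_singleton]
  rwa [((F N).isSingular.isClique.subset inter_subset_left).eq_of_rank_le_one hone.le hp'
    (⟨hF.subset hXN hzX, hzN'⟩ : z ∈ (F N).1 ∩ (F N').1)]

theorem exists_forall_mem (hF : IsIsometricGeneratorMap f F) (p : P) :
    ∃ p' : P', ∀ M : Q.Generator, p ∈ M.1 → p' ∈ (F M).1 := by
  obtain ⟨N, hpN⟩ := (isClique_singleton (Q := Q) p).exists_generator_superset
  obtain ⟨N', -, hN'N⟩ := (isSingular_singleton p).exists_generator_inter_eq N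
  rw [inter_eq_left.2 hpN, inter_comm] at hN'N
  rw [singleton_subset_iff] at hpN
  have hle := hF.rank_inter_le N N'
  rw [hN'N, rank_singleton] at hle
  obtain ⟨p', hp'N, hp'N'⟩ := nonempty_of_rank_pos hle
  suffices h : ∀ M : Q.Generator, p ∈ M.1 →
      p' ∈ (F M).1 ∧ ∃ M' : Q.Generator, M.1 ∩ M'.1 = {p} ∧ p' ∈ (F M').1 from
    ⟨p', fun M hpM => (h M hpM).1⟩
  intro M
  induction M using Generator.gallery_induction (N := N) with
  | base => exact fun _ => ⟨hp'N, N', hN'N, hp'N'⟩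
  | step K M X hXK hXM hsub _ ih =>
    intro hpK
    have hpX : p ∈ X.1 := hsub ⟨hpK, hpN⟩
    obtain ⟨hp'M, M', hMM', hp'M'⟩ := ih (hXM hpX)
    obtain ⟨X', K', hpX', hX'M', hX'K', hKK'⟩ :=
      exists_generator_inter_eq_singleton hMM' hpX hXM hXK
    exact ⟨hF.subset hXK (hF.mem_of_inter_eq_singleton hMM' ⟨hp'M, hp'M'⟩ hpX hXM), K', hKK',
      hF.subset hX'K' (hF.mem_of_inter_eq_singleton ((inter_comm _ _).trans hMM') ⟨hp'M', hp'M⟩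
        hpX' hX'M')⟩

end IsIsometricGeneratorMap

/-! ### The induced map on points -/

namespace IsIsometricPointMap

theorem mem_of_mem (hφ : IsIsometricPointMap f F φ) {p : P} {X : Q.Submaximal n} (hp : p ∈ X.1) :
    φ p ∈ (f X).1 := by
  obtain ⟨M, hXM⟩ := X.isSingular.isClique.exists_generator_superset
  obtain ⟨u, huM, huX⟩ := not_subset.1 fun hsub : M.1 ⊆ X.1 => by
    have hle := rank_mono X.isSingular.isClique hsub
    have hX := X.rank_add_one
    rw [M.rank_eq] at hle
    omega
  obtain ⟨N, hXN, huN⟩ := X.isSingular.exists_generator_superset_notMem huX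
  rw [← hφ.inter_eq (by rintro rfl; exact huN huM) hXM hXN]
  exact ⟨hφ.mem (hXM hp), hφ.mem (hXN hp)⟩

theorem notMem_of_notMem_perp (hφ : IsIsometricPointMap f F φ) {p : P} {X : Q.Submaximal n}
    (hp : p ∉ Q.perp X.1) : φ p ∉ (f X).1 := by
  intro hpX
  obtain ⟨Y, hpY, hY⟩ := exists_submaximal_mem_disjoint_perp hp
  exact ((le_edist_of_disjoint_perp hY).trans (hφ.edist_eq X Y).ge).not_gt
    (edist_lt_of_mem hpX (hφ.mem_of_mem hpY))

theorem injective (hφ : IsIsometricPointMap f F φ) : Function.Injective φ := by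
  intro p q hpq
  by_contra hne
  obtain hn | rfl := (two_le_of_isShultSpaceOfRank Q).lt_or_eq
  · obtain ⟨X, hpX, hqX⟩ := exists_submaximal_mem_notMem_perp (Q := Q) hn (Ne.symm hne)
    exact hφ.notMem_of_notMem_perp hqX (hpq ▸ hφ.mem_of_mem hpX)
  · let point (x : P) : Q.Submaximal 2 :=
      .ofRank (isSingular_singleton x) (by rw [rank_singleton])
    have hpoint (x : P) : {φ x} = (f (point x)).1 :=
      (isSingular_singleton (φ x)).eq_of_subset_of_rank_le (f (point x)).isSingular.isClique
        (singleton_subset_iff.2 (hφ.mem_of_mem (rfl : x ∈ (point x).1)))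
        (by have := (f (point x)).rank_add_one; rw [rank_singleton]; omega)
    have heq : f (point p) = f (point q) :=
      Subtype.ext (by rw [← hpoint, ← hpoint, hpq])
    exact hne (singleton_injective (congrArg Subtype.val (hφ.map_injective heq)))

theorem mem_iff (hφ : IsIsometricPointMap f F φ) {p : P} {X : Q.Submaximal n} :
    φ p ∈ (f X).1 ↔ p ∈ X.1 := by
  refine ⟨fun hpf => by_contra fun hpX => ?_, hφ.mem_of_mem⟩
  have hperp : p ∈ Q.perp X.1 := by_contra fun h => hφ.notMem_of_notMem_perp h hpf
  have hX := X.rank_add_one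
  have hn := two_le_of_isShultSpaceOfRank Q
  obtain ⟨m, hm⟩ := nonempty_of_rank_pos (by omega : 0 < Q.rank X.1)
  obtain ⟨M, hXM, hpM⟩ := X.isSingular.exists_generator_superset_notMem hpX
  have hpm : p ∈ Q.perp {m} := mem_perp_singleton.2 (hperp m hm)
  have hS : Q.IsSingular (Q.span {p, m}) := ((isClique_singleton m).insert hpm).isSingular_span
  have hrS := rank_span_insert (isSingular_singleton m) hpm (by rintro rfl; exact hpX hm)
  obtain ⟨N, hSN, hNM⟩ := hS.exists_generator_inter_eq M
  have hmN : m ∈ N.1 := hSN (subset_span_insert p {m} rfl)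
  have hpN : p ∈ N.1 := hSN (mem_span_insert p {m})
  have hlt := rank_lt_of_ssubset (hS.inter M.isSingular.1) hS.isClique
    ⟨inter_subset_left, fun hsub => hpM (hsub (mem_span_insert p {m})).2⟩
  have hrank := hφ.rank_inter_eq hmN (hXM hm)
  rw [hNM] at hrank
  rw [rank_singleton] at hrS
  have heq : φ p = φ m :=
    ((F N).isSingular.isClique.subset inter_subset_left).eq_of_rank_le_one (by omega)
      (⟨hφ.mem hpN, hφ.subset hXM hpf⟩ : φ p ∈ (F N).1 ∩ (F M).1)
      ⟨hφ.mem hmN, hφ.mem (hXM hm)⟩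
  exact hpX (hφ.injective heq ▸ hm)

theorem coll_iff (hφ : IsIsometricPointMap f F φ) (p q : P) :
    Q'.Coll (φ p) (φ q) ↔ Q.Coll p q := by
  refine ⟨fun hc => by_contra fun hpq => ?_, fun hc => ?_⟩
  · obtain ⟨M, hpM⟩ := (isClique_singleton (Q := Q) p).exists_generator_superset
    rw [singleton_subset_iff] at hpM
    have hqM : q ∉ M.1 := fun hqM => hpq (M.isSingular.isClique hpM q hqM)
    let X := M.interPerp hqM
    have hpX : p ∉ X.1 := fun hp => hpq (mem_perp_singleton.1 hp.2)
    have hqX : q ∉ X.1 := fun hq => hqM hq.1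
    have hqperp : q ∈ Q.perp X.1 :=
      singleton_subset_iff.1 (subset_perp_comm.1 inter_subset_right)
    let N := X.join hqperp hqX
    have hqN : q ∈ N.1 := X.mem_join hqperp hqX
    have hXM : X.1 ⊆ M.1 := inter_subset_left
    have hXN : X.1 ⊆ N.1 := X.subset_join hqperp hqX
    have hφq : φ q ∈ (F M).1 := (f X).mem_of_mem_perp (hφ.subset hXM) (hφ.mem hpM)
      (mt hφ.mem_iff.1 hpX)
      (perp_anti (hφ.subset hXN) ((F N).isSingular.isClique (hφ.mem hqN))) hc.symm
    have hqf : φ q ∈ (F M).1 ∩ (F N).1 := ⟨hφq, hφ.mem hqN⟩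
    rw [hφ.inter_eq (fun h => hqM (by rwa [h])) hXM hXN] at hqf
    exact hqX (hφ.mem_iff.1 hqf)
  · obtain ⟨M, hM⟩ :=
      ((isClique_singleton q).insert (mem_perp_singleton.2 hc)).exists_generator_superset
    exact (F M).isSingular.isClique (hφ.mem (hM (mem_insert p {q}))) _
      (hφ.mem (hM (mem_insert_of_mem p rfl)))

theorem isCollinearityPreservingInjection (hφ : IsIsometricPointMap f F φ) :
    Q.IsCollinearityPreservingInjection Q' φ :=
  ⟨hφ.injective, hφ.coll_iff⟩

end IsIsometricPointMap

theorem exists_isIsometricPointMap (hf : ∀ X Y,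
    (Q'.submaximalGraph n).edist (f X) (f Y) = (Q.submaximalGraph n).edist X Y) :
    ∃ F φ, IsIsometricPointMap f F φ := by
  obtain ⟨F, hF⟩ := exists_isIsometricGeneratorMap hf
  choose φ hφ using hF.exists_forall_mem
  exact ⟨F, φ, hF, fun {p M} => hφ p M⟩

end Maps

section Image

variable {φ : P → P'}

theorem IsClique.image {A : Set P} (hA : Q.IsClique A)
    (hφ : Q.IsCollinearityPreservingInjection Q' φ) : Q'.IsClique (φ '' A) := by
  rintro _ ⟨p, hp, rfl⟩ _ ⟨q, hq, rfl⟩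
  exact (hφ.2 p q).2 (hA hp q hq)

variable [Q.IsShultSpace] [Q'.IsShultSpace]

theorem Indep.image {I : Set P} (hI : Q.Indep I) (hc : Q.IsClique I)
    (hφ : Q.IsCollinearityPreservingInjection Q' φ) : Q'.Indep (φ '' I) := by
  rintro _ ⟨x, hx, rfl⟩ hmem
  obtain ⟨q, hq, hxq⟩ :=
    (hc.subset sdiff_subset).isSingular_span.exists_mem_perp_not_coll (hI x hx)
  rw [perp_span] at hq
  refine hxq ((hφ.2 x q).1 (span_subset (isSubspace_perp {φ q}) ?_ hmem _ rfl))
  rintro _ ⟨⟨y, hy, rfl⟩, hyx⟩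
  have hyx : y ≠ x := fun h => hyx (congrArg φ h)
  exact mem_perp_singleton.2 ((hφ.2 y q).2 (hq y ⟨hy, hyx⟩).symm)

theorem rank_le_rank_image {A : Set P} (hA : Q.IsClique A)
    (hφ : Q.IsCollinearityPreservingInjection Q' φ) : Q.rank A ≤ Q'.rank (φ '' A) := by
  obtain ⟨I, hI⟩ := hA.exists_isBasis
  have hIc := hA.subset hI.subset
  have hbasis : Q'.IsBasis (φ '' I) (φ '' I) := ⟨subset_rfl, hI.indep.image hIc hφ, subset_span _⟩
  calc Q.rank A = I.ncard := hI.rank_eq_ncard hA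
    _ = (φ '' I).ncard := (ncard_image_of_injective I hφ.1).symm
    _ = Q'.rank (φ '' I) := (hbasis.rank_eq_ncard (hIc.image hφ)).symm
    _ ≤ Q'.rank (φ '' A) := rank_mono (hA.image hφ) (image_mono hI.subset)

end Image

theorem IsIsometricPointMap.eq_span_image [Q.IsShultSpaceOfRank n] [Q'.IsShultSpaceOfRank n]
    {f : Q.Submaximal n → Q'.Submaximal n} {F : Q.Generator → Q'.Generator} {φ : P → P'}
    (hφ : IsIsometricPointMap f F φ) (X : Q.Submaximal n) : (f X).1 = Q'.span (φ '' X.1) := by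
  have hinj := hφ.isCollinearityPreservingInjection
  have hclique := X.isSingular.isClique.image hinj
  have hrank := rank_le_rank_image X.isSingular.isClique hinj
  have hX := X.rank_add_one
  have hfX := (f X).rank_add_one
  refine (hclique.isSingular_span.eq_of_subset_of_rank_le (f X).isSingular.isClique
    (span_subset (f X).isSingular.1 (image_subset_iff.2 fun p hp => hφ.mem_of_mem hp)) ?_).symm
  rw [rank_span hclique]
  omega

end PartialLinearSpace

theorem theorem3_general {P : Type u} {P' : Type v} (Q : PartialLinearSpace P)
    (Q' : PartialLinearSpace P') (n : ℕ) [Q.IsShultSpaceOfRank n] [Q'.IsShultSpaceOfRank n]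
    (f : Q.Grassmannian ((n : ℤ) - 2) → Q'.Grassmannian ((n : ℤ) - 2))
    (hf : ∀ X Y, (Q'.grassmannGraph ((n : ℤ) - 2)).edist (f X) (f Y) =
      (Q.grassmannGraph ((n : ℤ) - 2)).edist X Y) :
    ∃ φ : P → P', Q.IsCollinearityPreservingInjection Q' φ ∧
      ∀ S : Q.Grassmannian ((n : ℤ) - 2), (f S).1 = Q'.span (φ '' S.1) := by
  obtain ⟨F, φ, hφ⟩ := PartialLinearSpace.exists_isIsometricPointMap hf
  exact ⟨φ, hφ.isCollinearityPreservingInjection, hφ.eq_span_image⟩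

theorem theorem3 {P : Type u} {P' : Type v} (Q : PartialLinearSpace P)
    (Q' : PartialLinearSpace P') (n : ℕ)
    (hQ : Q.IsPolarSpaceOfRank n ∨ Q.IsThinPolarSpaceOfRank n)
    (hQ' : Q'.IsPolarSpaceOfRank n)
    (f : Q.grassmannGraph ((n : ℤ) - 2) ↪g Q'.grassmannGraph ((n : ℤ) - 2))
    (hf : f.IsIsometric) :
    ∃ φ : P → P', Q.IsCollinearityPreservingInjection Q' φ ∧
      ∀ S : Q.Grassmannian ((n : ℤ) - 2), (f S).1 = Q'.span (φ '' S.1) := by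
  have := hQ.elim (·.isShultSpaceOfRank) (·.isShultSpaceOfRank)
  have := hQ'.isShultSpaceOfRank
  exact theorem3_general Q Q' n f hf
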